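/- **Setting.** A base station (BS) with $K\ge 1$ antennas sits at the origin of $\mathbb R^2$; a half-duplex user (UE) is at distance $d>0$. Eavesdroppers (EDs) form a Poisson point process $\Phi$ of intensity $\rho>0$ on the closed disk of radius $R$ about the origin (and no points outside it). The fading coefficients $h_{B_kU}$ and $h_{B_kE_e}$ ($1\le k\le K$, $e\in\Phi$) are circularly symmetric complex Gaussian with mean $0$ and $\mathbb E|h|^2=1$, mutually independent and independent of $\Phi$. The path-loss exponent is $\alpha=p/q$ with positive integers $p,q$; the transmit power is $P_B>0$, the noise variance $\sigma^2>0$. The BS transmits from an antenna $B_*$ that maximizes $|h_{B_kU}|^2d^{-\alpha}$, so that the SNR of the UE and the largest SNR of the (independently acting) EDs are $$\gamma_{BU}=\frac{P_B}{\sigma^2}\max_{k}\frac{|h_{B_kU}|^2}{d^{\alpha}},\qquad \gamma_{BE}=\frac{P_B}{\sigma^2}\max_{e\in\Phi}\frac{|h_{B_*E_e}|^2}{d_{BE_e}^{\alpha}}\quad(\text{with }\max\emptyset=0),$$ where $d_{BE_e}$ is the distance of ED $e$ from the BS. For a target secrecy rate $\varepsilon$ put $\beta=2^{\varepsilon}$;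 the (high-SNR) secrecy outage probability is $P_{so}(R)=\mathbb P(\gamma_{BU}/\gamma_{BE}<\beta)$. Let $a_k=kd^{\alpha}$, $b=\pi\rho\,\Gamma(1+2/\alpha)\beta^{2/\alpha}$, and $$P_\infty=1-\sum_{k=1}^K(-1)^{k+1}\binom Kk\frac{\sqrt{pq}}{2^{\frac{p+2q-3}2}\pi^{\frac{p+2q}2-1}}\;G^{p+2q,0}_{0,p+2q}\!\left(\frac{a_k^{2q}b^p}{p^p4^qq^{2q}}\,\middle|\begin{array}{c}-\\0,\frac1p,\dots,\frac{p-1}p,\frac1{2q},\frac2{2q},\dots,1\end{array}\right),$$ where for $z>0$ the Meijer $G$-function is $G^{m,0}_{0,m}(z\,|\,v_1,\dots,v_m)=\frac1{2\pi i}\int_{c-i\infty}^{c+i\infty}\prod_{j=1}^m\Gamma(v_j+s)\,z^{-s}\,ds$ for any $c>\max_j(-v_j)$. **Proposition.** 1. $P_{so}(R)\to P_\infty$ as $R\to\infty$. 2. For every $R$, $$P_{so}(R)=1-\int_0^\infty f(x)\,F_R(x/\beta)\,dx,\qquad f(x)=\sum_{k=1}^K(-1)^{k+1}\binom Kk a_ke^{-a_kx},\qquad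 F_R(y)=\mathbb P\Big(\gamma_{BE}<\tfrac{P_B}{\sigma^2}y\Big),$$ and the $R$-dependent correction to $F_\infty(y)=\exp\big(-\tfrac{2\pi\rho}{\alpha y^{2/\alpha}}\Gamma(\tfrac2\alpha)\big)$ decays exponentially in $R^\alpha$: for every $y_0>0$ there are $C,R_0>0$ such that for all $R\ge R_0$ and $y\ge y_0$ $$\Big|\frac{F_R(y)}{F_\infty(y)}-1\Big|\le C\,\frac{2\pi\rho}{\alpha y^{2/\alpha}}\,R^{2-\alpha}y^{2/\alpha-1}e^{-yR^\alpha}.$$ 3. There are $C,c>0$, depending only on $K,\alpha,d,\rho,\varepsilon,P_B,\sigma^2$, such that $|P_{so}(R)-P_\infty|\le C\exp\big(-cR^{2\alpha/(\alpha+2)}\big)$ for all $R\ge1$. 4. If $\alpha=2$, then $$P_\infty=1-2\sum_{k=1}^K(-1)^{k+1}\binom Kk\sqrt{a_kb}\;\mathcal K_1\big(2\sqrt{a_kb}\big),$$ where $\mathcal K_1(x)=\int_0^\infty e^{-x\cosh t}\cosh t\,dt$ is the modified Bessel function of the second kind of order one. -/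

import Mathlib

open MeasureTheory ProbabilityTheory Filter Topology

noncomputable section

namespace SecrecyOutage

/-! ### Special functions -/

/-- The integrand (without the power of the argument) of the Mellin–Barnes integral of the Meijer
`G`-function `G^{m,n}_{s,t}` with upper parameters `u` and lower parameters `v`, in the
convention where it is integrated against `z ^ (-w)`. (`Complex.Gamma` is `0` at its poles, so
`(Complex.Gamma w)⁻¹` is the entire function `1 / Γ`.) -/
def meijerGKernel (m n : ℕ) {s t : ℕ} (u : Fin s → ℂ) (v : Fin t → ℂ) (w : ℂ) : ℂ :=
  (∏ j : Fin t, if (j : ℕ) < m then Complex.Gamma (v j + w) else (Complex.Gamma (1 - v j - w))⁻¹) *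
  (∏ j : Fin s, if (j : ℕ) < n then Complex.Gamma (1 - u j - w) else (Complex.Gamma (u j + w))⁻¹)

/-- The vertical line `Re w = c` separates the poles of the `Γ(v_j + w)`, `j < m` (on its left)
from the poles of the `Γ(1 - u_j - w)`, `j < n` (on its right). -/
def SeparatesPoles (m n : ℕ) {s t : ℕ} (u : Fin s → ℂ) (v : Fin t → ℂ) (c : ℝ) : Prop :=
  (∀ j : Fin t, (j : ℕ) < m → -(v j).re < c) ∧ (∀ j : Fin s, (j : ℕ) < n → c < 1 - (u j).re)

open Classical in
/-- The Meijer `G`-function `G^{m,n}_{s,t}(z | u; v)` of a positive argument `z`, as the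
Mellin–Barnes integral `(1 / 2πi) ∫_{c-i∞}^{c+i∞} (kernel w) z ^ (-w) dw` along a vertical line that
separates the two families of poles (if there is such a line; when `n = 0` there always is). -/
def meijerG (m n : ℕ) {s t : ℕ} (u : Fin s → ℂ) (v : Fin t → ℂ) (z : ℝ) : ℂ :=
  if h : ∃ c : ℝ, SeparatesPoles m n u v c then mellinInv h.choose (meijerGKernel m n u v) z else 0

/-- The modified Bessel function of the second kind of order `ν`, at `x > 0`. -/
def besselK (ν x : ℝ) : ℝ :=
  ∫ t in Set.Ioi (0 : ℝ), Real.exp (-x * Real.cosh t) * Real.cosh (ν * t)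

/-! ### Fading and Poisson point processes -/

/-- The law of a circularly symmetric complex Gaussian variable with mean `0` and `E|h|² = 1`. -/
def complexGaussian : Measure ℂ :=
  ((gaussianReal 0 (1 / 2)).prod (gaussianReal 0 (1 / 2))).map Complex.measurableEquivRealProd.symm

/-- The plane `ℝ²`. -/
abbrev Plane : Type := EuclideanSpace ℝ (Fin 2)

open Classical in
/-- The number of points `X 0, …, X (N - 1)` that lie in `A`. -/
def pointCount {Ω : Type*} (N : Ω → ℕ) (X : ℕ → Ω → Plane) (A : Set Plane) (ω : Ω) : ℕ :=
  ((Finset.range (N ω)).filter (fun e => X e ω ∈ A)).card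

/-- The random finite family of points `X 0, …, X (N - 1)` is a (measurably enumerated) Poisson
point process with finite intensity measure `Λ`: the number of points in a measurable set `A` is
Poisson with mean `Λ A`, and the numbers of points in disjoint measurable sets are independent. -/
structure IsPoissonPointProcess {Ω : Type*} [MeasurableSpace Ω] (N : Ω → ℕ) (X : ℕ → Ω → Plane)
    (Λ : Measure Plane) (μ : Measure Ω) : Prop where
  measurable_number : Measurable N
  measurable_point : ∀ e, Measurable (X e)
  law : ∀ A : Set Plane, MeasurableSet A →
    HasLaw (pointCount N X A) (poissonMeasure (Λ A).toNNReal) μ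
  indep : ∀ (n : ℕ) (A : Fin n → Set Plane), (∀ i, MeasurableSet (A i)) →
    Pairwise (fun i j => Disjoint (A i) (A j)) → iIndepFun (fun i => pointCount N X (A i)) μ

/-! ### The downlink with a half-duplex user -/

/-- A probability space carrying the randomness of the downlink: a base station (BS) at the origin
with `K` antennas, one user (UE), and eavesdroppers (EDs) that form a Poisson point process of
intensity `ρ` in the closed disk of radius `R` about the BS. `hBU k` is the fading coefficient from
antenna `k` to the UE and `hBE k e` the one from antenna `k` to the `e`-th ED (`e < N`), which sits
at `X e`. All fading coefficients are standard complex Gaussian (Rayleigh fading), mutually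
independent, and independent of the point process. -/
structure Downlink (K : ℕ) (ρ R : ℝ) where
  Ω : Type*
  [mΩ : MeasurableSpace Ω]
  μ : Measure Ω
  [prob : IsProbabilityMeasure μ]
  hBU : Fin K → Ω → ℂ
  hBE : Fin K → ℕ → Ω → ℂ
  N : Ω → ℕ
  X : ℕ → Ω → Plane
  measurable_hBU : ∀ k, Measurable (hBU k)
  measurable_hBE : ∀ k e, Measurable (hBE k e)
  law_hBU : ∀ k, HasLaw (hBU k) complexGaussian μ
  law_hBE : ∀ k e, HasLaw (hBE k e) complexGaussian μ
  poisson : IsPoissonPointProcess N X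
    (ENNReal.ofReal ρ • volume.restrict (Metric.closedBall (0 : Plane) R)) μ
  indep_fading : iIndepFun
    (Sum.elim hBU (fun i : Fin K × ℕ => hBE i.1 i.2) : Fin K ⊕ (Fin K × ℕ) → Ω → ℂ) μ
  indep_points : IndepFun
    (fun ω => ((fun k => hBU k ω, fun k e => hBE k e ω) : (Fin K → ℂ) × (Fin K → ℕ → ℂ)))
    (fun ω => ((N ω, fun e => X e ω) : ℕ × (ℕ → Plane))) μ

attribute [instance] Downlink.mΩ Downlink.prob

namespace Downlink

variable {K : ℕ} [NeZero K] {ρ R : ℝ}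

/-- Transmit antenna selection: an antenna with the largest gain to the UE. -/
def selected (M : Downlink K ρ R) (α d : ℝ) (ω : M.Ω) : Fin K :=
  Classical.epsilon fun k => ∀ j, ‖M.hBU j ω‖ ^ 2 / d ^ α ≤ ‖M.hBU k ω‖ ^ 2 / d ^ α

/-- The SNR at the UE, at distance `d` from the BS: path-loss exponent `α`, transmit power `PB`,
noise variance `σ2`, no jamming. -/
def snrUE (M : Downlink K ρ R) (α d PB σ2 : ℝ) (ω : M.Ω) : ENNReal :=
  ENNReal.ofReal (PB * (⨆ k, ‖M.hBU k ω‖ ^ 2 / d ^ α) / σ2)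

/-- The largest SNR among the EDs, which listen to the selected antenna; `0` if there is no ED. -/
def snrED (M : Downlink K ρ R) (α d PB σ2 : ℝ) (ω : M.Ω) : ENNReal :=
  ⨆ e ∈ Finset.range (M.N ω),
    ENNReal.ofReal (PB * ‖M.hBE (M.selected α d ω) e ω‖ ^ 2) /
      ENNReal.ofReal (‖M.X e ω‖ ^ α) / ENNReal.ofReal σ2

/-- The secrecy outage probability `P(γ_BU / γ_BE < β)`, `β = 2 ^ ε`, for target secrecy rate `ε`.
In `ENNReal` a positive number divided by `0` is `∞`: there is no outage without EDs. -/
def outageProb (M : Downlink K ρ R) (α d PB σ2 ε : ℝ) : ℝ :=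
  M.μ.real {ω | M.snrUE α d PB σ2 ω / M.snrED α d PB σ2 ω < ENNReal.ofReal (2 ^ ε)}

/-- The distribution function of the largest ED SNR in units of the transmit SNR `PB / σ2`. -/
def cdfED (M : Downlink K ρ R) (α d PB σ2 y : ℝ) : ℝ :=
  M.μ.real {ω | M.snrED α d PB σ2 ω < ENNReal.ofReal (PB / σ2 * y)}

end Downlink

/-! ### The closed forms -/

/-- `a_k = k d^α`. -/
def aCoeff (α d : ℝ) (k : ℕ) : ℝ := k * d ^ α

/-- `b = π ρ Γ(1 + 2/α) β^{2/α}` with `β = 2 ^ ε`. -/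
def bCoeff (α ρ ε : ℝ) : ℝ := Real.pi * ρ * Real.Gamma (1 + 2 / α) * ((2 : ℝ) ^ ε) ^ (2 / α)

/-- The density `∑_k (-1)^{k+1} C(K,k) a_k e^{-a_k x}` of the UE SNR in units of `PB / σ2`. -/
def densityUE (K : ℕ) (α d x : ℝ) : ℝ :=
  ∑ k ∈ Finset.Icc 1 K,
    (-1) ^ (k + 1) * (K.choose k : ℝ) * aCoeff α d k * Real.exp (-aCoeff α d k * x)

/-- The limit `exp (-(2πρ / (α y^{2/α})) Γ(2/α))` of the ED distribution function as `R → ∞`. -/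
def limitCdfED (α ρ y : ℝ) : ℝ :=
  Real.exp (-(2 * Real.pi * ρ / (α * y ^ (2 / α))) * Real.Gamma (2 / α))

/-- The lower parameters `0, 1/p, …, (p-1)/p, 1/(2q), 2/(2q), …, 1`. -/
def lowerParams (p q : ℕ) : Fin (p + 2 * q) → ℂ :=
  Fin.append (fun i : Fin p => ((i : ℕ) : ℂ) / p)
    (fun i : Fin (2 * q) => (((i : ℕ) : ℂ) + 1) / (2 * q))

/-- The closed form of the secrecy outage probability for path-loss exponent `α = p / q`. -/
def outageClosedForm (K p q : ℕ) (d ρ ε : ℝ) : ℂ :=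
  1 - ∑ k ∈ Finset.Icc 1 K, (-1) ^ (k + 1) * (K.choose k : ℂ) *
    ((Real.sqrt (p * q) / ((2 : ℝ) ^ (((p : ℝ) + 2 * q - 3) / 2) *
      Real.pi ^ (((p : ℝ) + 2 * q) / 2 - 1)) : ℝ) : ℂ) *
    meijerG (p + 2 * q) 0 (Fin.elim0 : Fin 0 → ℂ) (lowerParams p q)
      (aCoeff (p / q) d k ^ (2 * q) * bCoeff (p / q) ρ ε ^ p / (p ^ p * 4 ^ q * q ^ (2 * q)))

end SecrecyOutage

end

noncomputable section

namespace SecrecyOutage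

/-! ### The Gauss multiplication formula -/

/-! Conditioned on the gains to the user, the selected antenna is fixed, so the eavesdroppers see
i.i.d. coefficients with |h|² ~ Exp(1), independent of the points. A point at x keeps its normalized
SNR below y with probability 1 - e^{-y‖x‖^α}. The probability generating functional
(`integral_prod_eq_exp`) turns this into the void probability exp(-ρ ∫ e^{-y‖x‖^α} dx) over the disk
(`Downlink.measure_forall_mem`). The best user gain has distribution function (1 - e^{-d^α x})^K
with density f, so the outage probability is one minus the f-mixture of void probabilities at x/β
(`Downlink.outageProb_eq`).

Over the whole plane the exponent is a Gamma integral, and the mixture becomes a signed sum of I(θ,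
c) = ∫ e^{-x - c x^{-θ}} dx with θ = 2/α. The Mellin transform of I(θ, ·) is Γ(s) Γ(θs + 1). At s =
pw, θ = 2q/p this is Γ(pw) Γ(2qw + 1), which Gauss's multiplication formula splits into the p + 2q
Gamma factors of the Meijer kernel; Mellin inversion then gives the closed form
(`prefactor_mul_meijerG`, `outageClosedForm_eq`). For α = 2 one has θ = 1, and x = √c e^t produces
the Bessel function.

All dependence on R sits in F_R / F_∞ = exp(ρ · tail), the tail being the mass outside the disk. For
y bounded below, a sharp tail bound gives the relative correction. Uniformly in y, split at Y =
R^{-α²/(α+2)}: below Y the void probability itself is tiny, above Y the tail is, and both exponents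
have order R^{2α/(α+2)} (`abs_voidProb_sub_limitCdfED_le`). The limit R → ∞ is read off from that
rate. -/

lemma factorial_pow_mul_pow_div (n m : ℕ) (hn : n ≠ 0) (hm : m ≠ 0) :
    (m.factorial : ℝ) ^ n * (n : ℝ) ^ (n * m) / ((n * m).factorial * √m ^ (n - 1)) =
      Stirling.stirlingSeq m ^ n / Stirling.stirlingSeq (n * m) * (√2 ^ (n - 1) / √n) := by
  obtain ⟨n, rfl⟩ := Nat.exists_eq_succ_of_ne_zero hn
  have hm0 : (0 : ℝ) < m := by exact_mod_cast Nat.pos_of_ne_zero hm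
  have hn0 : (0 : ℝ) < ((n + 1 : ℕ) : ℝ) := by positivity
  have h1 : √(2 * (((n + 1) * m : ℕ) : ℝ)) = √2 * (√((n + 1 : ℕ) : ℝ) * √m) := by
    rw [Nat.cast_mul, Real.sqrt_mul (by norm_num), Real.sqrt_mul hn0.le]
  have h2 : √(2 * (m : ℝ)) = √2 * √m := Real.sqrt_mul (by norm_num) _
  have s2 : √2 ≠ 0 := by positivity
  have sm : √(m : ℝ) ≠ 0 := by positivity
  have sn : √((n + 1 : ℕ) : ℝ) ≠ 0 := by positivity
  have e1 : (((n + 1) * m : ℕ) / Real.exp 1 : ℝ) ^ ((n + 1) * m) =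
      ((m / Real.exp 1 : ℝ) ^ m) ^ (n + 1) * ((n + 1 : ℕ) : ℝ) ^ ((n + 1) * m) := by
    rw [← pow_mul, mul_comm m, ← mul_pow, Nat.cast_mul]
    congr 1
    ring
  have f1 : (((n + 1) * m).factorial : ℝ) ≠ 0 := by positivity
  have f2 : ((m / Real.exp 1 : ℝ) ^ m) ≠ 0 := by positivity
  simp only [Stirling.stirlingSeq, Nat.succ_eq_add_one, h1, h2, e1]
  rw [div_pow, mul_pow, mul_pow, Nat.add_sub_cancel]
  generalize (m / Real.exp 1 : ℝ) ^ m = E at *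
  generalize √(m : ℝ) = a at *
  generalize √((n + 1 : ℕ) : ℝ) = b at *
  generalize √(2 : ℝ) = c at *
  have : ((n + 1 : ℕ) : ℝ) ^ ((n + 1) * m) ≠ 0 := by positivity
  generalize ((n + 1 : ℕ) : ℝ) ^ ((n + 1) * m) = G at *
  field_simp
  ring

/-- Stirling: each Stirling sequence tends to √π. This is the source of the constant in Gauss's
formula. -/
lemma tendsto_factorial_pow_mul_pow_div (n : ℕ) (hn : n ≠ 0) :
    Tendsto (fun m : ℕ => (m.factorial : ℝ) ^ n * (n : ℝ) ^ (n * m) /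
      ((n * m).factorial * √m ^ (n - 1))) atTop (𝓝 (√(2 * Real.pi) ^ (n - 1) / √n)) := by
  have hS := Stirling.tendsto_stirlingSeq_sqrt_pi
  have hS' : Tendsto (fun m : ℕ => Stirling.stirlingSeq (n * m)) atTop (𝓝 √Real.pi) :=
    hS.comp (tendsto_id.const_mul_atTop' (Nat.pos_of_ne_zero hn))
  have hpi : √Real.pi ≠ 0 := by positivity
  have h := ((hS.pow n).div hS' hpi).mul_const (√2 ^ (n - 1) / √n)
  have e : √Real.pi ^ n / √Real.pi * (√2 ^ (n - 1) / √n) = √(2 * Real.pi) ^ (n - 1) / √n := by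
    rw [Real.sqrt_mul (by norm_num), mul_pow]
    obtain ⟨n, rfl⟩ := Nat.exists_eq_succ_of_ne_zero hn
    rw [Nat.succ_eq_add_one, Nat.add_sub_cancel, pow_succ]
    field_simp
  rw [e] at h
  refine h.congr' ?_
  filter_upwards [eventually_ne_atTop 0] with m hm
  exact (factorial_pow_mul_pow_div n m hn hm).symm

/-- Each factor is (nw + k + nj)/n, and k + nj runs exactly once through the integers below nM. -/
lemma prod_prod_add_div (n M : ℕ) (hn : n ≠ 0) (w : ℂ) :
    ∏ k ∈ Finset.range n, ∏ j ∈ Finset.range M, (w + k / n + j) =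
      (∏ i ∈ Finset.range (n * M), (n * w + i)) / (n : ℂ) ^ (n * M) := by
  have hn' : (n : ℂ) ≠ 0 := by exact_mod_cast hn
  rw [Finset.prod_comm]
  induction M with
  | zero => simp
  | succ M ih =>
    rw [Finset.prod_range_succ, ih, Nat.mul_succ, Finset.prod_range_add, pow_add, mul_div_mul_comm]
    congr 1
    rw [← Finset.card_range n, ← Finset.prod_const, Finset.card_range, ← Finset.prod_div_distrib]
    refine Finset.prod_congr rfl fun k _ => ?_
    push_cast
    field_simp
    ring

lemma prod_cpow_eq_cpow_sum {ι : Type*} (s : Finset ι) (f : ι → ℂ) {x : ℂ} (hx : x ≠ 0) :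
    ∏ i ∈ s, x ^ f i = x ^ ∑ i ∈ s, f i := by
  classical
  induction s using Finset.induction_on with
  | empty => simp
  | insert a s ha ih => rw [Finset.prod_insert ha, Finset.sum_insert ha, ih, Complex.cpow_add _ _ hx]

/-- The shifts k/n add up to (n - 1)/2, whence the power of √m. -/
lemma prod_cpow_add_div (n m : ℕ) (hn : n ≠ 0) (hm : m ≠ 0) (w : ℂ) :
    ∏ k ∈ Finset.range n, (m : ℂ) ^ (w + k / n) = (m : ℂ) ^ (n * w) * ((√m : ℝ) : ℂ) ^ (n - 1) := by
  have hm' : (m : ℂ) ≠ 0 := by exact_mod_cast hm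
  have hn' : (n : ℂ) ≠ 0 := by exact_mod_cast hn
  have hs : ((√m : ℝ) : ℂ) = (m : ℂ) ^ (1 / 2 : ℂ) := by
    rw [Real.sqrt_eq_rpow, Complex.ofReal_cpow (by positivity)]
    simp
  rw [hs, ← Complex.cpow_nat_mul, ← Complex.cpow_add _ _ hm', prod_cpow_eq_cpow_sum _ _ hm']
  congr 1
  rw [Finset.sum_add_distrib, Finset.sum_const, Finset.card_range, nsmul_eq_mul,
    ← Finset.sum_div]
  congr 1
  have h : ((∑ i ∈ Finset.range n, i : ℕ) : ℂ) * 2 = n * (n - 1 : ℕ) := by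
    exact_mod_cast Finset.sum_range_id_mul_two n
  push_cast at h
  field_simp
  linear_combination h

/-- Controls the n - 1 surplus denominator factors when n Gamma sequences of index m are compared
with one of index nm. -/
lemma tendsto_prod_add_div (n : ℕ) (w : ℂ) :
    Tendsto (fun m : ℕ => (∏ i ∈ Finset.range (n - 1), (n * w + ((n * m + 1 + i : ℕ) : ℂ))) /
      (m : ℂ) ^ (n - 1)) atTop (𝓝 ((n : ℂ) ^ (n - 1))) := by
  have h : ∀ i : ℕ, Tendsto (fun m : ℕ => (n * w + ((n * m + 1 + i : ℕ) : ℂ)) / m) atTop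
      (𝓝 (n : ℂ)) := by
    intro i
    have h0 := (tendsto_const_div_atTop_nhds_zero_nat (𝕜 := ℂ) (n * w + 1 + i)).add_const (n : ℂ)
    rw [zero_add] at h0
    refine h0.congr' ?_
    filter_upwards [eventually_ne_atTop 0] with m hm
    have hm' : (m : ℂ) ≠ 0 := by exact_mod_cast hm
    push_cast
    field_simp
    ring
  have := tendsto_finsetProd (Finset.range (n - 1)) fun i _ => h i
  simp only [Finset.prod_div_distrib, Finset.prod_const, Finset.card_range] at this
  exact this

/-- The **Gauss multiplication formula** in the right half-plane. -/
theorem prod_Gamma_add_div (n : ℕ) (hn : n ≠ 0) {w : ℂ} (hw : 0 < w.re) :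
    ∏ k ∈ Finset.range n, Complex.Gamma (w + k / n) =
      ((√(2 * Real.pi) ^ (n - 1) * √n : ℝ) : ℂ) * (n : ℂ) ^ (-(n * w)) * Complex.Gamma (n * w) := by
  have hn' : (n : ℂ) ≠ 0 := by exact_mod_cast hn
  have hn0 : (0 : ℝ) < n := by exact_mod_cast Nat.pos_of_ne_zero hn
  have h1 : Tendsto (fun m : ℕ => ∏ k ∈ Finset.range n, Complex.GammaSeq (w + k / n) m) atTop
      (𝓝 (∏ k ∈ Finset.range n, Complex.Gamma (w + k / n))) :=
    tendsto_finsetProd _ fun k _ => Complex.GammaSeq_tendsto_Gamma _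
  have h2 : Tendsto (fun m : ℕ => Complex.GammaSeq (n * w) (n * m)) atTop
      (𝓝 (Complex.Gamma (n * w))) :=
    (Complex.GammaSeq_tendsto_Gamma _).comp
      (tendsto_id.const_mul_atTop' (Nat.pos_of_ne_zero hn))
  have h3 := (Complex.continuous_ofReal.tendsto _).comp (tendsto_factorial_pow_mul_pow_div n hn)
  have h4 := tendsto_prod_add_div n w
  have h5 := ((h3.mul_const ((n : ℂ) ^ n)).div h4 (pow_ne_zero _ hn')).mul_const
    ((n : ℂ) ^ (-(n * w))) |>.mul h2
  refine tendsto_nhds_unique h1 (Tendsto.congr' ?_ (h5.trans_eq ?_))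
  · filter_upwards [eventually_ne_atTop 0] with m hm
    have hm' : (m : ℂ) ≠ 0 := by exact_mod_cast hm
    -- A Gamma sequence of index m has m + 1 denominator factors, so the n sequences have n(m + 1)
    -- of them against nm + 1 for index nm.
    have hsplit : n * (m + 1) = n * m + 1 + (n - 1) := by
      rw [Nat.mul_succ]; have := Nat.pos_of_ne_zero hn; omega
    simp only [Complex.GammaSeq, Finset.prod_div_distrib, Finset.prod_mul_distrib,
      Finset.prod_const, Finset.card_range, prod_cpow_add_div n m hn hm,
      prod_prod_add_div n (m + 1) hn, Function.comp]
    have hprod : ∏ i ∈ Finset.range (n * (m + 1)), (n * w + (i : ℂ)) =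
        (∏ i ∈ Finset.range (n * m + 1), (n * w + (i : ℂ))) *
          ∏ i ∈ Finset.range (n - 1), (n * w + ((n * m + 1 + i : ℕ) : ℂ)) := by
      rw [hsplit, Finset.prod_range_add]
    rw [hprod, Nat.mul_succ, pow_add]
    simp only [Pi.div_apply]
    have hne : ∀ i : ℕ, (n : ℂ) * w + i ≠ 0 := by
      intro i h
      have := congrArg Complex.re h
      simp at this
      have : 0 < n * w.re := by positivity
      have : (0 : ℝ) ≤ i := by positivity
      linarith
    have p1 : ∏ i ∈ Finset.range (n * m + 1), (n * w + (i : ℂ)) ≠ 0 :=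
      Finset.prod_ne_zero_iff.mpr fun i _ => hne i
    have p2 : ∏ i ∈ Finset.range (n - 1), (n * w + ((n * m + 1 + i : ℕ) : ℂ)) ≠ 0 :=
      Finset.prod_ne_zero_iff.mpr fun i _ => hne _
    have c1 : ((n * m : ℕ) : ℂ) ^ ((n : ℂ) * w) = (n : ℂ) ^ ((n : ℂ) * w) * (m : ℂ) ^ (n * w) := by
      rw [Nat.cast_mul, Complex.natCast_mul_natCast_cpow]
    have c2 : (n : ℂ) ^ ((n : ℂ) * w) ≠ 0 := by simp [Complex.cpow_eq_zero_iff, hn']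
    have hsm : ((√m : ℝ) : ℂ) ≠ 0 := by
      have : (0:ℝ) < m := by exact_mod_cast Nat.pos_of_ne_zero hm
      exact_mod_cast (Real.sqrt_pos.mpr this).ne'
    have hsq : (m : ℂ) ^ (n - 1) = ((√m : ℝ) : ℂ) ^ (n - 1) * ((√m : ℝ) : ℂ) ^ (n - 1) := by
      rw [← mul_pow, ← Complex.ofReal_mul, Real.mul_self_sqrt (by positivity), Complex.ofReal_natCast]
    have hf : (((n * m).factorial : ℕ) : ℂ) ≠ 0 := by exact_mod_cast Nat.factorial_ne_zero _
    rw [c1, Complex.cpow_neg, hsq]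
    push_cast at p1 p2 ⊢
    generalize ∏ i ∈ Finset.range (n * m + 1), (n * w + (i : ℂ)) = A at *
    generalize ∏ i ∈ Finset.range (n - 1), (n * w + ((n : ℂ) * m + 1 + i)) = B at *
    generalize (((n * m).factorial : ℕ) : ℂ) = F at *
    generalize (n : ℂ) ^ ((n : ℂ) * w) = G at *
    have := pow_ne_zero (n - 1) hsm
    generalize ((√m : ℝ) : ℂ) ^ (n - 1) = H at *
    field_simp
  · congr 1
    have hs : ((√n : ℝ) : ℂ) ≠ 0 := by exact_mod_cast (Real.sqrt_pos.mpr hn0).ne'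
    have hsq : (n : ℂ) = ((√n : ℝ) : ℂ) * ((√n : ℝ) : ℂ) := by
      rw [← Complex.ofReal_mul, Real.mul_self_sqrt (by positivity), Complex.ofReal_natCast]
    have hp : (n : ℂ) ^ n = n ^ (n - 1) * n := by
      rw [← pow_succ, Nat.sub_add_cancel (Nat.pos_of_ne_zero hn)]
    rw [hp]
    push_cast
    field_simp
    rw [pow_two, ← hsq]

/-! ### The Meijer `G`-function as a Laplace-type integral -/

/-- The integral `∫₀^∞ e^{-x - c x^{-θ}} dx`. -/
def stretchedIntegral (θ c : ℝ) : ℝ :=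
  ∫ x in Set.Ioi (0 : ℝ), Real.exp (-x) * Real.exp (-(x ^ (-θ) * c))

lemma norm_Gamma_le {s : ℂ} (hs : 0 < s.re) : ‖Complex.Gamma s‖ ≤ Real.Gamma s.re := by
  rw [Complex.Gamma_eq_integral hs, Real.Gamma_eq_integral hs, Complex.GammaIntegral]
  refine (norm_integral_le_integral_norm _).trans (le_of_eq ?_)
  refine setIntegral_congr_fun measurableSet_Ioi fun x hx => ?_
  simp only [Set.mem_Ioi] at hx
  simp [Complex.norm_cpow_eq_rpow_re_of_pos hx, Complex.norm_exp]

/-- Dominated by e^{-x}. Mellin inversion needs continuity at the point of evaluation. -/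
lemma continuousAt_stretchedIntegral (θ : ℝ) {c : ℝ} (hc : 0 < c) :
    ContinuousAt (stretchedIntegral θ) c := by
  refine continuousAt_of_dominated (bound := fun x => Real.exp (-x)) ?_ ?_ ?_ ?_
  · exact Eventually.of_forall fun c => (by fun_prop : Measurable _).aestronglyMeasurable
  · filter_upwards [lt_mem_nhds hc] with c hc
    filter_upwards [ae_restrict_mem measurableSet_Ioi] with x hx
    have : 0 ≤ x ^ (-θ) * c := mul_nonneg (Real.rpow_nonneg (le_of_lt hx) _) hc.le
    rw [Real.norm_of_nonneg (by positivity)]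
    exact mul_le_of_le_one_right (by positivity) (Real.exp_le_one_iff.mpr (by linarith))
  · exact Real.GammaIntegral_convergent one_pos |>.congr_fun (fun x _ => by simp) measurableSet_Ioi
  · exact Eventually.of_forall fun x => by fun_prop

/-- Tonelli with c integrated first: the inner integral of the norm is Γ(Re s) x^{θ Re s} e^{-x},
which is integrable in x. -/
lemma integrable_stretched_prod {θ : ℝ} (hθ : 0 < θ) {s : ℂ} (hs : 0 < s.re) :
    Integrable (Function.uncurry fun c x : ℝ => (c : ℂ) ^ (s - 1) *
        ((Real.exp (-x) * Real.exp (-(x ^ (-θ) * c)) : ℝ) : ℂ))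
      ((volume.restrict (Set.Ioi 0)).prod (volume.restrict (Set.Ioi 0))) := by
  have hmeas : Measurable (Function.uncurry fun c x : ℝ => (c : ℂ) ^ (s - 1) *
        ((Real.exp (-x) * Real.exp (-(x ^ (-θ) * c)) : ℝ) : ℂ)) := by
    simp only [Function.uncurry_def]
    fun_prop
  have hnorm : ∀ {c x : ℝ}, 0 < c → ‖(c : ℂ) ^ (s - 1) *
      ((Real.exp (-x) * Real.exp (-(x ^ (-θ) * c)) : ℝ) : ℂ)‖ =
        Real.exp (-x) * (c ^ (s.re - 1) * Real.exp (-(x ^ (-θ) * c))) := by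
    intro c x hc
    rw [norm_mul, Complex.norm_cpow_eq_rpow_re_of_pos hc, Complex.norm_real,
      Real.norm_of_nonneg (by positivity)]
    simp only [Complex.sub_re, Complex.one_re]
    ring
  rw [integrable_prod_iff' hmeas.aestronglyMeasurable]
  constructor
  · filter_upwards [ae_restrict_mem measurableSet_Ioi] with x hx
    have hx' : 0 < x ^ (-θ) := Real.rpow_pos_of_pos hx _
    have h := (integrableOn_rpow_mul_exp_neg_mul_rpow (p := 1) (s := s.re - 1) (b := x ^ (-θ))
      (by linarith) one_pos hx').const_mul (Real.exp (-x))
    refine (integrable_norm_iff ?_).mp (h.congr ?_)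
    · exact (hmeas.comp (measurable_id.prodMk measurable_const)).aestronglyMeasurable
    · filter_upwards [ae_restrict_mem measurableSet_Ioi] with c hc
      simp only [Function.uncurry_apply_pair]
      rw [hnorm hc]
      simp
  · have h := (Real.GammaIntegral_convergent (s := θ * s.re + 1) (by positivity)).const_mul
      (Real.Gamma s.re)
    refine h.congr ?_
    filter_upwards [ae_restrict_mem measurableSet_Ioi] with x hx
    have hx' : 0 < x ^ (-θ) := Real.rpow_pos_of_pos hx _
    simp only [Function.uncurry_apply_pair]
    rw [setIntegral_congr_fun measurableSet_Ioi fun c hc => hnorm hc, integral_const_mul,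
      Real.integral_rpow_mul_exp_neg_mul_Ioi hs hx', one_div, Real.rpow_neg (le_of_lt hx), inv_inv,
      ← Real.rpow_mul (le_of_lt hx)]
    simp
    ring

lemma mellinConvergent_stretchedIntegral {θ : ℝ} (hθ : 0 < θ) {s : ℂ} (hs : 0 < s.re) :
    MellinConvergent (fun c => (stretchedIntegral θ c : ℂ)) s := by
  refine (integrable_stretched_prod hθ hs).integral_prod_left.congr ?_
  refine Eventually.of_forall fun c => ?_
  simp only [Function.uncurry_apply_pair]
  rw [integral_const_mul, integral_complex_ofReal]
  rfl

/-- By Fubini the c-integral gives Γ(s) x^{θs}, and the remaining x-integral is Euler's integral for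
Γ(θs + 1). -/
lemma mellin_stretchedIntegral {θ : ℝ} (hθ : 0 < θ) {s : ℂ} (hs : 0 < s.re) :
    mellin (fun c => (stretchedIntegral θ c : ℂ)) s =
      Complex.Gamma s * Complex.Gamma (θ * s + 1) := by
  have h1 : mellin (fun c => (stretchedIntegral θ c : ℂ)) s =
      ∫ c in Set.Ioi (0 : ℝ), ∫ x in Set.Ioi (0 : ℝ), (c : ℂ) ^ (s - 1) *
        ((Real.exp (-x) * Real.exp (-(x ^ (-θ) * c)) : ℝ) : ℂ) := by
    refine integral_congr_ae (Eventually.of_forall fun c => ?_)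
    simp only
    rw [integral_const_mul, integral_complex_ofReal]
    rfl
  rw [h1, integral_integral_swap (integrable_stretched_prod hθ hs),
    Complex.Gamma_eq_integral (s := θ * s + 1) (by simp; positivity), Complex.GammaIntegral,
    ← integral_const_mul]
  refine setIntegral_congr_fun measurableSet_Ioi fun x hx => ?_
  simp only [Set.mem_Ioi] at hx
  have hx' : 0 < x ^ (-θ) := Real.rpow_pos_of_pos hx _
  have h2 := Complex.integral_cpow_mul_exp_neg_mul_Ioi hs hx'
  have h3 : ((1 : ℂ) / ((x ^ (-θ) : ℝ) : ℂ)) ^ s = (x : ℂ) ^ (θ * s) := by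
    rw [Real.rpow_neg hx.le, one_div, Complex.ofReal_inv, inv_inv, Complex.cpow_def_of_ne_zero,
      Complex.cpow_def_of_ne_zero, ← Complex.ofReal_log (Real.rpow_nonneg hx.le _),
      Real.log_rpow hx, ← Complex.ofReal_log hx.le]
    · push_cast; ring_nf
    · exact_mod_cast hx.ne'
    · exact_mod_cast (Real.rpow_pos_of_pos hx _).ne'
  rw [h3] at h2
  simp only [add_sub_cancel_right]
  calc _ = ∫ c in Set.Ioi (0 : ℝ), (Real.exp (-x) : ℂ) *
        ((c : ℂ) ^ (s - 1) * Complex.exp (-(((x ^ (-θ) : ℝ) : ℂ) * c))) := by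
        congr 1 with c
        push_cast
        ring
    _ = _ := by
        rw [integral_const_mul, h2]
        push_cast
        ring

/-- Quadratic decay suffices: Γ(s) = Γ(s + 2) / (s(s + 1)), while Γ(s + 2) and Γ(θs + 1) are bounded
on the line by their values at the real part. -/
lemma verticalIntegrable_Gamma_mul_Gamma {θ : ℝ} (hθ : 0 < θ) {σ : ℝ} (hσ : 0 < σ) :
    Complex.VerticalIntegrable (fun s => Complex.Gamma s * Complex.Gamma (θ * s + 1)) σ := by
  have hre : ∀ y : ℝ, ((σ : ℂ) + y * Complex.I).re = σ := by simp
  have hG : ∀ s : ℂ, 0 < s.re → ContinuousAt Complex.Gamma s := fun s hs =>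
    (Complex.differentiableAt_Gamma s fun m h => by
      have := congrArg Complex.re h
      simp at this
      have : (0 : ℝ) ≤ m := by positivity
      linarith).continuousAt
  have hcont : Continuous fun y : ℝ => Complex.Gamma ((σ : ℂ) + y * Complex.I) *
      Complex.Gamma (θ * ((σ : ℂ) + y * Complex.I) + 1) := by
    rw [continuous_iff_continuousAt]
    intro y
    refine ContinuousAt.mul ?_ ?_
    · exact ContinuousAt.comp (f := fun y : ℝ => (σ : ℂ) + y * Complex.I) (hG _ (by simpa using hσ))
        (by fun_prop)
    · exact ContinuousAt.comp (f := fun y : ℝ => (θ : ℂ) * ((σ : ℂ) + y * Complex.I) + 1)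
        (hG _ (by simp; positivity)) (by fun_prop)
  -- Chosen so that m(1 + y²) ≤ σ² + y² = |s|².
  set m := min (σ ^ 2) 1 with hm
  have hm0 : 0 < m := by positivity
  refine (integrable_inv_one_add_sq.const_mul
    (Real.Gamma (σ + 2) * Real.Gamma (θ * σ + 1) * m⁻¹)).mono' hcont.aestronglyMeasurable
    (Eventually.of_forall fun y => ?_)
  set s : ℂ := (σ : ℂ) + y * Complex.I with hs
  have hsre : s.re = σ := hre y
  have hs0 : s ≠ 0 := fun h => by rw [h] at hsre; simp at hsre; linarith
  have hs1 : s + 1 ≠ 0 := fun h => by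
    have := congrArg Complex.re h
    simp [hsre] at this
    linarith
  have hnsq : ‖s‖ ^ 2 = σ ^ 2 + y ^ 2 := by
    rw [← Complex.normSq_eq_norm_sq, Complex.normSq_apply]
    simp [hs]
    ring
  have hle : ‖s‖ ≤ ‖s + 1‖ := by
    refine (sq_le_sq₀ (norm_nonneg _) (norm_nonneg _)).mp ?_
    rw [← Complex.normSq_eq_norm_sq, ← Complex.normSq_eq_norm_sq, Complex.normSq_apply,
      Complex.normSq_apply]
    simp [hs]
    nlinarith
  have hrec : Complex.Gamma (s + 2) = (s + 1) * s * Complex.Gamma s := by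
    rw [show s + 2 = (s + 1) + 1 by ring, Complex.Gamma_add_one _ hs1, Complex.Gamma_add_one _ hs0]
    ring
  have hb1 : ‖Complex.Gamma (s + 2)‖ ≤ Real.Gamma (σ + 2) := by
    have := norm_Gamma_le (s := s + 2) (by simp [hsre]; positivity)
    simpa [hsre] using this
  have hb2 : ‖Complex.Gamma (θ * s + 1)‖ ≤ Real.Gamma (θ * σ + 1) := by
    have := norm_Gamma_le (s := θ * s + 1) (by simp [hsre]; positivity)
    simpa [hsre] using this
  have hb3 : m * (1 + y ^ 2) * ‖Complex.Gamma s‖ ≤ Real.Gamma (σ + 2) := by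
    refine le_trans ?_ hb1
    rw [hrec, norm_mul, norm_mul]
    refine mul_le_mul_of_nonneg_right ?_ (norm_nonneg _)
    have h1 : m ≤ σ ^ 2 := min_le_left _ _
    have h2 : m ≤ 1 := min_le_right _ _
    calc m * (1 + y ^ 2) ≤ ‖s‖ ^ 2 := by rw [hnsq]; nlinarith [sq_nonneg y]
      _ ≤ ‖s + 1‖ * ‖s‖ := by rw [pow_two]; gcongr
  rw [norm_mul]
  have h0 : 0 < 1 + y ^ 2 := by positivity
  calc ‖Complex.Gamma s‖ * ‖Complex.Gamma (θ * s + 1)‖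
      ≤ (Real.Gamma (σ + 2) / (m * (1 + y ^ 2))) * Real.Gamma (θ * σ + 1) := by
        gcongr
        rw [le_div_iff₀ (by positivity)]
        linarith
    _ = _ := by field_simp

/-- Gauss's formula is applied at w to the first p parameters, and at w + 1/(2q) to the other 2q,
which start at 1/(2q) instead of 0; that shift produces the + 1 in the second Gamma and the division
by 2q. -/
lemma meijerGKernel_lowerParams (p q : ℕ) (hp : 0 < p) (hq : 0 < q) {w : ℂ} (hw : 0 < w.re) :
    meijerGKernel (p + 2 * q) 0 (Fin.elim0 : Fin 0 → ℂ) (lowerParams p q) w =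
      ((√(2 * Real.pi) ^ (p - 1) * √p * (√(2 * Real.pi) ^ (2 * q - 1) * √(2 * q : ℕ)) /
        (2 * q : ℕ) : ℝ) : ℂ) * (((p : ℝ) ^ p * (2 * q : ℕ) ^ (2 * q) : ℝ) : ℂ) ^ (-w) *
        (Complex.Gamma (p * w) * Complex.Gamma ((2 * q : ℕ) * w + 1)) := by
  have hp' : (p : ℂ) ≠ 0 := by exact_mod_cast hp.ne'
  have hq2 : 2 * q ≠ 0 := by omega
  have hq' : ((2 * q : ℕ) : ℂ) ≠ 0 := by exact_mod_cast hq2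
  have e1 : ∏ i : Fin p, Complex.Gamma (((i : ℕ) : ℂ) / p + w) =
      ∏ k ∈ Finset.range p, Complex.Gamma (w + k / p) := by
    rw [Finset.prod_range]
    simp only [add_comm w]
  have e2 : ∏ i : Fin (2 * q), Complex.Gamma ((((i : ℕ) : ℂ) + 1) / (2 * q) + w) =
      ∏ k ∈ Finset.range (2 * q), Complex.Gamma ((w + 1 / (2 * q : ℕ)) + k / (2 * q : ℕ)) := by
    rw [Finset.prod_range]
    refine Finset.prod_congr rfl fun i _ => ?_
    congr 1
    push_cast
    ring
  have hw' : 0 < (w + 1 / (2 * q : ℕ)).re := by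
    have : (1 / ((2 * q : ℕ) : ℂ)) = ((1 / (2 * q : ℕ) : ℝ) : ℂ) := by push_cast; rfl
    rw [this, Complex.add_re, Complex.ofReal_re]
    positivity
  have e3 : ((2 * q : ℕ) : ℂ) * (w + 1 / (2 * q : ℕ)) = (2 * q : ℕ) * w + 1 := by field_simp
  have hD : (((p : ℝ) ^ p * (2 * q : ℕ) ^ (2 * q) : ℝ) : ℂ) ^ (-w) =
      (p : ℂ) ^ (-(p * w)) * ((2 * q : ℕ) : ℂ) ^ (-((2 * q : ℕ) * w)) := by
    rw [Complex.ofReal_mul, Complex.mul_cpow_ofReal_nonneg (by positivity) (by positivity)]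
    congr 1
    · rw [Complex.ofReal_pow, Complex.ofReal_natCast, ← Complex.natCast_cpow_natCast_mul]
      ring_nf
    · rw [Complex.ofReal_pow, Complex.ofReal_natCast, ← Complex.natCast_cpow_natCast_mul]
      ring_nf
  have e4 : ((2 * q : ℕ) : ℂ) ^ (-((2 * q : ℕ) * w + 1)) =
      ((2 * q : ℕ) : ℂ) ^ (-((2 * q : ℕ) * w)) / (2 * q : ℕ) := by
    rw [neg_add, Complex.cpow_add _ _ hq', Complex.cpow_neg_one]
    rfl
  rw [meijerGKernel]
  simp only [Fin.is_lt, if_true, Finset.univ_eq_empty, Finset.prod_empty, mul_one]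
  rw [Fin.prod_univ_add]
  simp only [lowerParams, Fin.append_left, Fin.append_right]
  rw [e1, e2, prod_Gamma_add_div p hp.ne' hw, prod_Gamma_add_div (2 * q) hq2 hw', e3, e4, hD]
  push_cast
  ring

/-- The root 1/p turns the Mellin variable w into pw with Jacobian p, and the dilation contributes
D^{-w}. -/
lemma mellin_stretchedIntegral_comp {p q : ℕ} (hp : 0 < p) (hq : 0 < q) {D : ℝ} (hD : 0 < D)
    {w : ℂ} (hw : 0 < w.re) :
    mellin (fun z : ℝ => (stretchedIntegral (2 * q / p) ((D * z) ^ (1 / p : ℝ)) : ℂ)) w =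
      (D : ℂ) ^ (-w) * (p * (Complex.Gamma (p * w) * Complex.Gamma ((2 * q : ℕ) * w + 1))) := by
  have hp' : (0 : ℝ) < p := by exact_mod_cast hp
  have hpc : (p : ℂ) ≠ 0 := by exact_mod_cast hp.ne'
  have hq' : (0 : ℝ) < q := by exact_mod_cast hq
  rw [mellin_comp_mul_left (fun t : ℝ => (stretchedIntegral (2 * q / p) (t ^ (1 / p : ℝ)) : ℂ)) w hD,
    mellin_comp_rpow (fun t : ℝ => (stretchedIntegral (2 * q / p) t : ℂ))]
  have h1 : w / ((1 / p : ℝ) : ℂ) = p * w := by push_cast; field_simp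
  have h2 : |(1 / p : ℝ)|⁻¹ = p := by rw [abs_of_pos (by positivity)]; simp
  rw [h1, h2, mellin_stretchedIntegral (by positivity) (by simp; positivity)]
  have h3 : (((2 * q / p : ℝ)) : ℂ) * (p * w) = (2 * q : ℕ) * w := by push_cast; field_simp
  rw [h3, smul_eq_mul, Complex.real_smul]
  push_cast
  rfl

lemma mellinInv_mellin_stretchedIntegral_comp {p q : ℕ} (hp : 0 < p) (hq : 0 < q) {D z σ : ℝ}
    (hD : 0 < D) (hz : 0 < z) (hσ : 0 < σ) :
    mellinInv σ (mellin fun z : ℝ => (stretchedIntegral (2 * q / p) ((D * z) ^ (1 / p : ℝ)) : ℂ)) z =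
      (stretchedIntegral (2 * q / p) ((D * z) ^ (1 / p : ℝ)) : ℂ) := by
  have hp' : (0 : ℝ) < p := by exact_mod_cast hp
  have hpc : (p : ℂ) ≠ 0 := by exact_mod_cast hp.ne'
  have hq' : (0 : ℝ) < q := by exact_mod_cast hq
  have hθ : (0 : ℝ) < 2 * q / p := by positivity
  refine mellinInv_mellin_eq σ _ hz ?_ ?_ ?_
  · rw [MellinConvergent.comp_mul_left
      (f := fun t : ℝ => (stretchedIntegral (2 * q / p) (t ^ (1 / p : ℝ)) : ℂ)) hD,
      MellinConvergent.comp_rpow (f := fun t : ℝ => (stretchedIntegral (2 * q / p) t : ℂ))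
        (by positivity)]
    refine mellinConvergent_stretchedIntegral hθ ?_
    have h1 : (σ : ℂ) / ((1 / p : ℝ) : ℂ) = (p * σ : ℝ) := by push_cast; field_simp
    rw [h1, Complex.ofReal_re]
    positivity
  · have hv := verticalIntegrable_Gamma_mul_Gamma hθ (mul_pos hp' hσ)
    -- On the line Re w = σ the factor D^{-w} has constant modulus, so vertical integrability is
    -- that of the Gamma product after y ↦ py.
    have hv' := (Integrable.comp_mul_left' hv hp'.ne').norm.const_mul (D ^ (-σ) * p)
    have hcont : Continuous fun y : ℝ => (D : ℂ) ^ (-(σ + y * Complex.I)) * p :=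
      (Continuous.const_cpow (by fun_prop) (Or.inl (by exact_mod_cast hD.ne'))).mul_const _
    have hm := (hcont.aestronglyMeasurable (μ := volume)).mul
      (Integrable.comp_mul_left' hv hp'.ne').aestronglyMeasurable
    refine hv'.mono' (hm.congr (Eventually.of_forall fun y => ?_)) (Eventually.of_forall fun y => ?_)
    · simp only [Pi.mul_apply]
      rw [mellin_stretchedIntegral_comp hp hq hD (by simpa using hσ), mul_assoc]
      congr 4
      · push_cast; ring
      · push_cast; field_simp
    · rw [mellin_stretchedIntegral_comp hp hq hD (by simpa using hσ), norm_mul, norm_mul,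
        Complex.norm_cpow_eq_rpow_re_of_pos hD, Complex.norm_natCast, ← mul_assoc]
      refine le_of_eq ?_
      congr 1
      · simp
      · congr 3
        · push_cast; ring
        · push_cast; field_simp
  · have h : ContinuousAt (fun z : ℝ => (D * z) ^ (1 / p : ℝ)) z :=
      ContinuousAt.rpow_const (by fun_prop) (Or.inl (by positivity))
    exact Complex.continuous_ofReal.continuousAt.comp
      (ContinuousAt.comp (g := stretchedIntegral (2 * q / p))
        (continuousAt_stretchedIntegral _ (by positivity)) h)

/-- The prefactor of the closed form is the inverse of the Gauss constants divided by the Jacobian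
p. -/
lemma prefactor_identity {p q : ℕ} (hp : 0 < p) (hq : 0 < q) :
    √(p * q) / ((2 : ℝ) ^ (((p : ℝ) + 2 * q - 3) / 2) * Real.pi ^ (((p : ℝ) + 2 * q) / 2 - 1)) *
      (√(2 * Real.pi) ^ (p - 1) * √p * (√(2 * Real.pi) ^ (2 * q - 1) * √(2 * q : ℕ)) / (2 * q : ℕ) / p)
      = 1 := by
  have hp' : (0 : ℝ) < p := by exact_mod_cast hp
  have hq' : (0 : ℝ) < q := by exact_mod_cast hq
  have h1 : √(2 * Real.pi) ^ (p - 1) * √(2 * Real.pi) ^ (2 * q - 1) =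
      2 ^ (((p : ℝ) + 2 * q - 3) / 2) * √2 * Real.pi ^ (((p : ℝ) + 2 * q) / 2 - 1) := by
    rw [← pow_add, Real.sqrt_eq_rpow, Real.sqrt_eq_rpow, ← Real.rpow_natCast, ← Real.rpow_mul (by positivity),
      ← Real.rpow_add (by norm_num), Real.mul_rpow (by norm_num) Real.pi_pos.le]
    rw [Nat.cast_add, Nat.cast_sub (by omega), Nat.cast_sub (by omega)]
    push_cast
    congr 2 <;> ring
  have h2 : √(p : ℝ) * √(p : ℝ) = p := Real.mul_self_sqrt hp'.le
  have h3 : √(q : ℝ) * √(q : ℝ) = q := Real.mul_self_sqrt hq'.le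
  have h4 : √(2 : ℝ) * √(2 : ℝ) = 2 := Real.mul_self_sqrt (by norm_num)
  have h5 : √((2 * q : ℕ) : ℝ) = √2 * √q := by
    push_cast
    rw [Real.sqrt_mul (by norm_num)]
  have h6 : √(p * q : ℝ) = √p * √q := Real.sqrt_mul hp'.le _
  rw [h5, h6]
  have hA : (0 : ℝ) < 2 ^ (((p : ℝ) + 2 * q - 3) / 2) := by positivity
  have hB : (0 : ℝ) < Real.pi ^ (((p : ℝ) + 2 * q) / 2 - 1) := by positivity
  generalize (2 : ℝ) ^ (((p : ℝ) + 2 * q - 3) / 2) = A at *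
  generalize Real.pi ^ (((p : ℝ) + 2 * q) / 2 - 1) = B at *
  push_cast
  rw [div_div, div_mul_div_comm, div_eq_one_iff_eq (by positivity)]
  calc _ = (√(2 * Real.pi) ^ (p - 1) * √(2 * Real.pi) ^ (2 * q - 1)) * (√p * √p) * (√q * √q) * √2 := by ring
    _ = (√2 * √2) * A * B * p * q := by rw [h1, h2, h3]; ring
    _ = _ := by rw [h4]; ring

theorem prefactor_mul_meijerG {p q : ℕ} (hp : 0 < p) (hq : 0 < q) {z : ℝ} (hz : 0 < z) :
    ((√(p * q) / ((2 : ℝ) ^ (((p : ℝ) + 2 * q - 3) / 2) *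
      Real.pi ^ (((p : ℝ) + 2 * q) / 2 - 1)) : ℝ) : ℂ) *
      meijerG (p + 2 * q) 0 (Fin.elim0 : Fin 0 → ℂ) (lowerParams p q) z =
    (stretchedIntegral (2 * q / p)
      (((p : ℝ) ^ p * (2 * q : ℕ) ^ (2 * q) * z) ^ (1 / p : ℝ)) : ℂ) := by
  have hp' : (0 : ℝ) < p := by exact_mod_cast hp
  have hpc : (p : ℂ) ≠ 0 := by exact_mod_cast hp.ne'
  have hre : ∀ j, 0 ≤ (lowerParams p q j).re := by
    intro j
    refine Fin.addCases (fun i => ?_) (fun i => ?_) j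
    · have : lowerParams p q (Fin.castAdd _ i) = (((i : ℕ) / p : ℝ) : ℂ) := by simp [lowerParams]
      rw [this, Complex.ofReal_re]
      positivity
    · have : lowerParams p q (Fin.natAdd _ i) = ((((i : ℕ) + 1) / (2 * q) : ℝ) : ℂ) := by
        simp [lowerParams]
      rw [this, Complex.ofReal_re]
      positivity
  have hex : ∃ c : ℝ, SeparatesPoles (p + 2 * q) 0 (Fin.elim0 : Fin 0 → ℂ) (lowerParams p q) c :=
    ⟨1, fun j _ => by linarith [hre j], fun j => j.elim0⟩
  rw [meijerG, dif_pos hex]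
  -- Since 0 is a lower parameter, every separating line lies in the right half-plane, so inversion
  -- applies whichever line was chosen.
  have hσ : 0 < hex.choose := by
    have h := hex.choose_spec.1 (Fin.castAdd _ (⟨0, hp⟩ : Fin p)) (by simp; omega)
    have h0 : (lowerParams p q (Fin.castAdd (2 * q) (⟨0, hp⟩ : Fin p))).re = 0 := by
      simp [lowerParams, -Fin.castAdd_mk]
    rw [h0, neg_zero] at h
    exact h
  generalize hex.choose = σ at hσ
  have hD : (0 : ℝ) < (p : ℝ) ^ p * (2 * q : ℕ) ^ (2 * q) := by positivity
  rw [← mellinInv_mellin_stretchedIntegral_comp hp hq hD hz hσ]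
  have hk : ∀ y : ℝ, meijerGKernel (p + 2 * q) 0 (Fin.elim0 : Fin 0 → ℂ) (lowerParams p q)
      (σ + y * Complex.I) =
      ((√(2 * Real.pi) ^ (p - 1) * √p * (√(2 * Real.pi) ^ (2 * q - 1) * √(2 * q : ℕ)) /
        (2 * q : ℕ) / p : ℝ) : ℂ) *
      mellin (fun z : ℝ => (stretchedIntegral (2 * q / p)
        (((p : ℝ) ^ p * (2 * q : ℕ) ^ (2 * q) * z) ^ (1 / p : ℝ)) : ℂ)) (σ + y * Complex.I) := by
    intro y
    rw [meijerGKernel_lowerParams p q hp hq (by simpa using hσ),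
      mellin_stretchedIntegral_comp hp hq hD (by simpa using hσ), Complex.ofReal_div _ (p : ℝ),
      Complex.ofReal_natCast]
    field_simp
  simp only [mellinInv, hk, smul_eq_mul]
  simp only [mul_left_comm _ ((√(2 * Real.pi) ^ (p - 1) * √p * (√(2 * Real.pi) ^ (2 * q - 1) *
    √(2 * q : ℕ)) / (2 * q : ℕ) / p : ℝ) : ℂ)]
  rw [integral_const_mul, mul_smul_comm, ← mul_assoc, ← Complex.ofReal_mul, prefactor_identity hp hq,
    Complex.ofReal_one, one_mul]

/-- The closed form as a sum of Laplace-type integrals. -/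
theorem outageClosedForm_eq {K p q : ℕ} (hp : 0 < p) (hq : 0 < q) {d ρ ε : ℝ} (hd : 0 < d)
    (hρ : 0 < ρ) :
    outageClosedForm K p q d ρ ε =
      ((1 - ∑ k ∈ Finset.Icc 1 K, (-1) ^ (k + 1) * (K.choose k : ℝ) *
        stretchedIntegral (2 / (p / q : ℝ))
          (aCoeff (p / q) d k ^ (2 / (p / q : ℝ)) * bCoeff (p / q) ρ ε) : ℝ) : ℂ) := by
  have hp' : (0 : ℝ) < p := by exact_mod_cast hp
  have hq' : (0 : ℝ) < q := by exact_mod_cast hq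
  have hb : 0 < bCoeff (p / q) ρ ε := by
    have := Real.Gamma_pos_of_pos (s := 1 + 2 / (p / q : ℝ)) (by positivity)
    have := Real.pi_pos
    unfold bCoeff
    positivity
  unfold outageClosedForm
  push_cast
  congr 1
  refine Finset.sum_congr rfl fun k hk => ?_
  have hk1 : 0 < k := (Finset.mem_Icc.mp hk).1
  have ha : 0 < aCoeff (p / q) d k := by unfold aCoeff; positivity
  rw [mul_assoc]
  congr 1
  have := prefactor_mul_meijerG hp hq (z := aCoeff (p / q) d k ^ (2 * q) * bCoeff (p / q) ρ ε ^ p /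
    (p ^ p * 4 ^ q * q ^ (2 * q))) (by positivity)
  push_cast at this ⊢
  rw [this]
  have e1 : (2 : ℝ) * q / p = 2 / (p / q) := by field_simp
  rw [e1]
  congr 2
  -- The scaling (2q)^{2q} p^p cancels the denominator of the Meijer argument, leaving a p-th power
  -- whose root is a^{2/α} b.
  have e2 : (p : ℝ) ^ p * (2 * q) ^ (2 * q) * (aCoeff (p / q) d k ^ (2 * q) *
      bCoeff (p / q) ρ ε ^ p / (p ^ p * 4 ^ q * q ^ (2 * q))) =
      (aCoeff (p / q) d k ^ (2 / (p / q : ℝ)) * bCoeff (p / q) ρ ε) ^ (p : ℝ) := by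
    rw [Real.mul_rpow (by positivity) hb.le, ← Real.rpow_mul ha.le, ← e1, div_mul_cancel₀ _ hp'.ne',
      Real.rpow_natCast, mul_pow (2 : ℝ), pow_mul (2 : ℝ)]
    rw [show (2 : ℝ) * q = ((2 * q : ℕ) : ℝ) by push_cast; rfl, Real.rpow_natCast]
    norm_num
    field_simp
  rw [e2, ← Real.rpow_mul (by positivity), mul_one_div_cancel hp'.ne', Real.rpow_one]

/-! ### Scaling and Bessel form of the Laplace-type integral -/

lemma integral_exp_mul_exp_rpow (θ b : ℝ) {a : ℝ} (ha : 0 < a) :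
    ∫ x in Set.Ioi (0 : ℝ), a * Real.exp (-a * x) * Real.exp (-(b * x ^ (-θ))) =
      stretchedIntegral θ (a ^ θ * b) := by
  have h := integral_comp_mul_left_Ioi
    (fun t : ℝ => Real.exp (-t) * Real.exp (-(t ^ (-θ) * (a ^ θ * b)))) 0 ha
  rw [mul_zero, smul_eq_mul] at h
  rw [eq_inv_mul_iff_mul_eq₀ ha.ne'] at h
  rw [stretchedIntegral, ← h, ← integral_const_mul]
  refine setIntegral_congr_fun measurableSet_Ioi fun x hx => ?_
  simp only [Set.mem_Ioi] at hx
  have : (a * x) ^ (-θ) * (a ^ θ * b) = b * x ^ (-θ) := by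
    rw [Real.mul_rpow ha.le hx.le, Real.rpow_neg ha.le]
    have := (Real.rpow_pos_of_pos ha θ).ne'
    field_simp
  simp only [this, neg_mul]
  ring

lemma integrableOn_stretched (θ : ℝ) {c : ℝ} (hc : 0 ≤ c) :
    IntegrableOn (fun x : ℝ => Real.exp (-x) * Real.exp (-(x ^ (-θ) * c))) (Set.Ioi 0) := by
  have h : IntegrableOn (fun x : ℝ => Real.exp (-x)) (Set.Ioi 0) :=
    (Real.GammaIntegral_convergent one_pos).congr_fun (fun x _ => by simp) measurableSet_Ioi
  refine Integrable.mono' h (by fun_prop : Measurable _).aestronglyMeasurable ?_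
  filter_upwards [ae_restrict_mem measurableSet_Ioi] with x hx
  have : 0 ≤ x ^ (-θ) * c := mul_nonneg (Real.rpow_nonneg (le_of_lt hx) _) hc
  rw [Real.norm_of_nonneg (by positivity)]
  exact mul_le_of_le_one_right (by positivity) (Real.exp_le_one_iff.mpr (by linarith))

/-- The order-one modified Bessel function as a Laplace-type integral. -/
theorem stretchedIntegral_one {c : ℝ} (hc : 0 < c) :
    stretchedIntegral 1 c = 2 * (√c * besselK 1 (2 * √c)) := by
  set r := √c with hr
  have hr0 : 0 < r := Real.sqrt_pos.mpr hc
  have hcr : c = r * r := (Real.mul_self_sqrt hc.le).symm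
  -- The substitution x = √c e^t makes the exponent x + c/x symmetric: it becomes 2√c cosh t.
  have himg : (fun t : ℝ => r * Real.exp t) '' Set.univ = Set.Ioi 0 := by
    ext x
    simp only [Set.image_univ, Set.mem_range, Set.mem_Ioi]
    constructor
    · rintro ⟨t, rfl⟩; positivity
    · intro hx
      exact ⟨Real.log (x / r), by rw [Real.exp_log (by positivity)]; field_simp⟩
  have hderiv : ∀ t ∈ (Set.univ : Set ℝ),
      HasDerivWithinAt (fun t : ℝ => r * Real.exp t) (r * Real.exp t) Set.univ t := fun t _ =>
    ((Real.hasDerivAt_exp t).const_mul r).hasDerivWithinAt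
  have hinj : Set.InjOn (fun t : ℝ => r * Real.exp t) Set.univ := by
    intro s _ t _ h
    exact Real.exp_injective (mul_left_cancel₀ hr0.ne' h)
  have hfun : ∀ t : ℝ, |r * Real.exp t| • (Real.exp (-(r * Real.exp t)) *
      Real.exp (-((r * Real.exp t) ^ (-1 : ℝ) * c))) =
      r * (Real.exp (-(2 * r) * Real.cosh t) * Real.exp t) := by
    intro t
    rw [abs_of_pos (by positivity), smul_eq_mul, ← Real.exp_add, Real.rpow_neg_one, hcr,
      Real.cosh_eq, Real.exp_neg t]
    have : -(r * Real.exp t) + -((r * Real.exp t)⁻¹ * (r * r)) =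
        -(2 * r) * ((Real.exp t + (Real.exp t)⁻¹) / 2) := by
      field_simp
      ring
    rw [this]
    ring
  have hInt := integrableOn_stretched 1 hc.le
  rw [← himg, integrableOn_image_iff_integrableOn_abs_deriv_smul MeasurableSet.univ hderiv hinj]
    at hInt
  simp only [hfun, integrableOn_univ] at hInt
  have hInt' : Integrable fun t : ℝ => Real.exp (-(2 * r) * Real.cosh t) * Real.exp t := by
    simpa [hr0.ne'] using hInt.const_mul r⁻¹
  -- Folding the negative half-line onto the positive one turns e^t into e^t + e^{-t} = 2 cosh t.
  have hneg : ∫ t in Set.Iic (0 : ℝ), Real.exp (-(2 * r) * Real.cosh t) * Real.exp t =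
      ∫ t in Set.Ioi (0 : ℝ), Real.exp (-(2 * r) * Real.cosh t) * Real.exp (-t) := by
    have := integral_comp_neg_Ioi (0 : ℝ)
      (fun t : ℝ => Real.exp (-(2 * r) * Real.cosh t) * Real.exp t)
    simp only [Real.cosh_neg, neg_zero] at this
    exact this.symm
  have hInt2 : Integrable fun t : ℝ => Real.exp (-(2 * r) * Real.cosh t) * Real.exp (-t) := by
    simpa using hInt'.comp_neg
  rw [stretchedIntegral, ← himg,
    integral_image_eq_integral_abs_deriv_smul MeasurableSet.univ hderiv hinj]
  simp only [hfun]
  rw [integral_const_mul, setIntegral_univ,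
    ← intervalIntegral.integral_Iic_add_Ioi hInt'.integrableOn hInt'.integrableOn (b := 0), hneg,
    ← integral_add hInt2.integrableOn hInt'.integrableOn, besselK, mul_left_comm,
    ← integral_const_mul 2]
  congr 1
  refine setIntegral_congr_fun measurableSet_Ioi fun t _ => ?_
  simp only [one_mul]
  rw [Real.cosh_eq]
  ring

/-! ### Masses of the disk and of its complement -/

/-- The integral of `e^{-y‖x‖^α}` over the disk of radius `R`. -/
def diskMass (α y R : ℝ) : ℝ :=
  ∫ x in Metric.closedBall (0 : Plane) R, Real.exp (-y * ‖x‖ ^ α)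

/-- The integral of `e^{-y‖x‖^α}` over the complement of the disk of radius `R`. -/
def tailMass (α y R : ℝ) : ℝ :=
  ∫ x in (Metric.closedBall (0 : Plane) R)ᶜ, Real.exp (-y * ‖x‖ ^ α)

lemma volume_real_ball_plane : volume.real (Metric.ball (0 : Plane) 1) = Real.pi := by
  rw [measureReal_def, EuclideanSpace.volume_ball_fin_two]
  simp [Real.pi_pos.le]

lemma integral_fun_norm_plane (f : ℝ → ℝ) :
    ∫ x : Plane, f ‖x‖ = 2 * Real.pi * ∫ r in Set.Ioi (0 : ℝ), r * f r := by
  rw [integral_fun_norm_addHaar, volume_real_ball_plane]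
  simp [mul_assoc]

lemma integrable_exp_neg_norm_rpow {α y : ℝ} (hα : 0 < α) (hy : 0 < y) :
    Integrable fun x : Plane => Real.exp (-y * ‖x‖ ^ α) := by
  have h := integrableOn_rpow_mul_exp_neg_mul_rpow (s := 1) (by norm_num) hα hy
  refine (integrable_fun_norm_addHaar (volume : Measure Plane)
    (f := fun r => Real.exp (-y * r ^ α))).mpr ?_
  simpa using h

lemma integral_exp_neg_norm_rpow {α y : ℝ} (hα : 0 < α) (hy : 0 < y) :
    ∫ x : Plane, Real.exp (-y * ‖x‖ ^ α) =
      2 * Real.pi / (α * y ^ (2 / α)) * Real.Gamma (2 / α) := by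
  rw [integral_fun_norm_plane fun r => Real.exp (-y * r ^ α)]
  have h := integral_rpow_mul_exp_neg_mul_rpow (q := 1) hα (by norm_num) hy
  simp only [Real.rpow_one] at h
  rw [h, show (1 : ℝ) + 1 = 2 by norm_num, neg_div, Real.rpow_neg hy.le]
  field_simp

lemma diskMass_add_tailMass {α y : ℝ} (hα : 0 < α) (hy : 0 < y) (R : ℝ) :
    diskMass α y R + tailMass α y R = 2 * Real.pi / (α * y ^ (2 / α)) * Real.Gamma (2 / α) := by
  rw [← integral_exp_neg_norm_rpow hα hy, diskMass, tailMass]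
  exact integral_add_compl measurableSet_closedBall (integrable_exp_neg_norm_rpow hα hy)

lemma tailMass_nonneg (α y R : ℝ) : 0 ≤ tailMass α y R :=
  integral_nonneg fun _ => by positivity

lemma diskMass_nonneg (α y R : ℝ) : 0 ≤ diskMass α y R :=
  integral_nonneg fun _ => by positivity

lemma tailMass_le {α y : ℝ} (hα : 0 < α) (hy : 0 < y) (R : ℝ) :
    tailMass α y R ≤ 2 * Real.pi / (α * y ^ (2 / α)) * Real.Gamma (2 / α) := by
  rw [← diskMass_add_tailMass hα hy R]
  linarith [diskMass_nonneg α y R]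

lemma tailMass_anti {α y y' : ℝ} (hα : 0 < α) (hy : 0 < y) (h : y ≤ y') (R : ℝ) :
    tailMass α y' R ≤ tailMass α y R := by
  refine setIntegral_mono (integrable_exp_neg_norm_rpow hα (hy.trans_le h)).integrableOn
    (integrable_exp_neg_norm_rpow hα hy).integrableOn fun x => ?_
  have : 0 ≤ ‖x‖ ^ α := by positivity
  exact Real.exp_le_exp.mpr (by nlinarith)

lemma diskMass_anti {α y y' : ℝ} (hα : 0 < α) (hy : 0 < y) (h : y ≤ y') (R : ℝ) :
    diskMass α y' R ≤ diskMass α y R := by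
  refine setIntegral_mono (integrable_exp_neg_norm_rpow hα (hy.trans_le h)).integrableOn
    (integrable_exp_neg_norm_rpow hα hy).integrableOn fun x => ?_
  have : 0 ≤ ‖x‖ ^ α := by positivity
  exact Real.exp_le_exp.mpr (by nlinarith)

/-- Half of the exponent is frozen at its value on the boundary circle; the other half keeps the
plane integral finite. Cruder than `tailMass_le_of_large`, but without a lower bound on y R^α. -/
lemma tailMass_le_exp {α y R : ℝ} (hα : 0 < α) (hy : 0 < y) (hR : 0 ≤ R) :
    tailMass α y R ≤ Real.exp (-(y / 2) * R ^ α) *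
      (2 * Real.pi / (α * (y / 2) ^ (2 / α)) * Real.Gamma (2 / α)) := by
  have hi := integrable_exp_neg_norm_rpow hα (half_pos hy)
  rw [← integral_exp_neg_norm_rpow hα (half_pos hy), ← integral_const_mul]
  refine le_trans ?_ (setIntegral_le_integral (hi.const_mul _)
    (Eventually.of_forall fun x => by positivity) (s := (Metric.closedBall (0 : Plane) R)ᶜ))
  refine setIntegral_mono_on (integrable_exp_neg_norm_rpow hα hy).integrableOn
    (hi.const_mul _).integrableOn measurableSet_closedBall.compl fun x hx => ?_
  simp only [Set.mem_compl_iff, Metric.mem_closedBall, dist_zero_right, not_le] at hx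
  have : R ^ α ≤ ‖x‖ ^ α := Real.rpow_le_rpow hR hx.le hα.le
  rw [← Real.exp_add]
  exact Real.exp_le_exp.mpr (by nlinarith)

/-- On the disk of radius y^{-1/α} the integrand is at least e^{-1}. -/
lemma le_diskMass {α y R : ℝ} (hα : 0 < α) (hy : 0 < y) (hR : y ^ (-(1 / α)) ≤ R) :
    Real.exp (-1) * (Real.pi * y ^ (-(2 / α))) ≤ diskMass α y R := by
  set r := y ^ (-(1 / α)) with hr
  have hr0 : 0 ≤ r := by positivity
  have hi := integrable_exp_neg_norm_rpow hα hy
  have h1 : ∫ x in Metric.closedBall (0 : Plane) r, Real.exp (-1) =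
      Real.exp (-1) * (Real.pi * y ^ (-(2 / α))) := by
    rw [setIntegral_const, measureReal_def, EuclideanSpace.volume_closedBall_fin_two]
    have : r ^ 2 = y ^ (-(2 / α)) := by
      rw [hr, ← Real.rpow_natCast, ← Real.rpow_mul hy.le]
      congr 1
      push_cast
      ring
    simp only [ENNReal.toReal_mul, ENNReal.toReal_pow, ENNReal.toReal_ofReal hr0, smul_eq_mul, this]
    simp [Real.pi_pos.le]
    ring
  rw [← h1]
  calc ∫ x in Metric.closedBall (0 : Plane) r, Real.exp (-1)
      ≤ ∫ x in Metric.closedBall (0 : Plane) r, Real.exp (-y * ‖x‖ ^ α) := by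
        refine setIntegral_mono_on (integrableOn_const measure_closedBall_lt_top.ne)
          hi.integrableOn measurableSet_closedBall fun x hx => ?_
        simp only [Metric.mem_closedBall, dist_zero_right] at hx
        have h2 : ‖x‖ ^ α ≤ r ^ α := Real.rpow_le_rpow (norm_nonneg _) hx hα.le
        have h3 : r ^ α = y⁻¹ := by
          rw [hr, ← Real.rpow_mul hy.le, neg_mul, one_div_mul_cancel hα.ne', Real.rpow_neg_one]
        rw [h3] at h2
        have : y * ‖x‖ ^ α ≤ 1 := by
          calc y * ‖x‖ ^ α ≤ y * y⁻¹ := by gcongr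
            _ = 1 := mul_inv_cancel₀ hy.ne'
        exact Real.exp_le_exp.mpr (by linarith)
    _ ≤ _ := setIntegral_mono_set hi.integrableOn (Eventually.of_forall fun x => by positivity)
        (Metric.closedBall_subset_closedBall hR).eventuallyLE

lemma tailMass_eq (α y : ℝ) {R : ℝ} (hR : 0 ≤ R) :
    tailMass α y R = 2 * Real.pi * ∫ r in Set.Ioi R, r * Real.exp (-y * r ^ α) := by
  have h := integral_fun_norm_plane ((Set.Ioi R).indicator fun r => Real.exp (-y * r ^ α))
  rw [tailMass, ← integral_indicator measurableSet_closedBall.compl]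
  have h2 : ∫ r in Set.Ioi (0 : ℝ), r * (Set.Ioi R).indicator (fun r => Real.exp (-y * r ^ α)) r =
      ∫ r in Set.Ioi R, r * Real.exp (-y * r ^ α) := by
    rw [← Set.inter_eq_self_of_subset_right (Set.Ioi_subset_Ioi hR),
      ← setIntegral_indicator measurableSet_Ioi, Set.inter_eq_self_of_subset_right
        (Set.Ioi_subset_Ioi hR)]
    congr 1 with r
    simp [Set.indicator]
  rw [← h2, ← h]
  congr 1 with x
  simp [Set.indicator]

/-- The weight r^{α-1} is the one for which the integrand has an elementary primitive. -/
lemma integral_Ioi_rpow_mul_exp {α y R : ℝ} (hα : 0 < α) (hy : 0 < y) (hR : 0 < R) :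
    IntegrableOn (fun r : ℝ => r ^ (α - 1) * Real.exp (-y * r ^ α)) (Set.Ioi R) ∧
    ∫ r in Set.Ioi R, r ^ (α - 1) * Real.exp (-y * r ^ α) = Real.exp (-y * R ^ α) / (α * y) := by
  have hi : IntegrableOn (fun r : ℝ => r ^ (α - 1) * Real.exp (-y * r ^ α)) (Set.Ioi R) :=
    (integrableOn_rpow_mul_exp_neg_mul_rpow (by linarith) hα hy).mono_set (Set.Ioi_subset_Ioi hR.le)
  refine ⟨hi, ?_⟩
  have hd : ∀ r ∈ Set.Ici R, HasDerivAt (fun r : ℝ => -(Real.exp (-y * r ^ α) / (α * y)))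
      (r ^ (α - 1) * Real.exp (-y * r ^ α)) r := by
    intro r hr
    have hr0 : 0 < r := hR.trans_le hr
    have h := (((Real.hasDerivAt_rpow_const (p := α) (Or.inl hr0.ne')).const_mul (-y)).exp.div_const
      (α * y)).neg
    refine h.congr_deriv ?_
    field_simp
  have ht : Tendsto (fun r : ℝ => -(Real.exp (-y * r ^ α) / (α * y))) atTop (𝓝 0) := by
    have h1 : Tendsto (fun r : ℝ => -y * r ^ α) atTop atBot :=
      (tendsto_rpow_atTop hα).const_mul_atTop_of_neg (by linarith)
    have h2 := ((Real.tendsto_exp_atBot.comp h1).div_const (α * y)).neg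
    simpa using h2
  rw [integral_Ioi_of_hasDerivAt_of_tendsto' hd hi ht]
  ring

/-- Write r = r^{2-α} r^{α-1}. Half of the exponential gain absorbs (r/R)^{2-α}: with L = log(r/R),
e^{αL} ≥ 1 + αL and y R^α ≥ 4/α give (2 - α)L ≤ 2L ≤ (y/2)(r^α - R^α). -/
lemma rpow_mul_exp_le {α y R r : ℝ} (hα : 0 < α) (hy : 0 < y) (hR : 0 < R)
    (hyR : 4 / α ≤ y * R ^ α) (hr : R ≤ r) :
    r * Real.exp (-y * r ^ α) ≤ R ^ (2 - α) * Real.exp (-(y / 2) * R ^ α) *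
      (r ^ (α - 1) * Real.exp (-(y / 2) * r ^ α)) := by
  have hr0 : 0 < r := hR.trans_le hr
  have hl : 0 ≤ Real.log (r / R) := Real.log_nonneg ((one_le_div hR).mpr hr)
  set L := Real.log (r / R) with hL
  have hrL : r ^ α = R ^ α * Real.exp (α * L) := by
    rw [mul_comm α, hL, ← Real.rpow_def_of_pos (by positivity), Real.div_rpow hr0.le hR.le]
    have := (Real.rpow_pos_of_pos hR α).ne'
    field_simp
  have hRr : r ^ (2 - α) = R ^ (2 - α) * Real.exp ((2 - α) * L) := by
    rw [mul_comm (2 - α), hL, ← Real.rpow_def_of_pos (by positivity), Real.div_rpow hr0.le hR.le]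
    have := (Real.rpow_pos_of_pos hR (2 - α)).ne'
    field_simp
  have key : (2 - α) * L ≤ y / 2 * (r ^ α - R ^ α) := by
    have h1 : α * L + 1 ≤ Real.exp (α * L) := Real.add_one_le_exp _
    have h2 : r ^ α - R ^ α = R ^ α * (Real.exp (α * L) - 1) := by rw [hrL]; ring
    have h3 : 2 * L = 4 / α / 2 * (α * L) := by field_simp; ring
    calc (2 - α) * L ≤ 2 * L := by nlinarith
      _ = 4 / α / 2 * (α * L) := h3
      _ ≤ y * R ^ α / 2 * (α * L) := by gcongr
      _ ≤ y * R ^ α / 2 * (Real.exp (α * L) - 1) := by gcongr; linarith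
      _ = _ := by rw [h2]; ring
  have hsplit : r = r ^ (2 - α) * r ^ (α - 1) := by
    rw [← Real.rpow_add hr0, show 2 - α + (α - 1) = 1 by ring, Real.rpow_one]
  calc r * Real.exp (-y * r ^ α)
      = R ^ (2 - α) * r ^ (α - 1) * (Real.exp ((2 - α) * L) * Real.exp (-y * r ^ α)) := by
        nth_rewrite 1 [hsplit]
        rw [hRr]
        ring
    _ ≤ R ^ (2 - α) * r ^ (α - 1) *
        (Real.exp (-(y / 2) * R ^ α) * Real.exp (-(y / 2) * r ^ α)) := by
        rw [← Real.exp_add, ← Real.exp_add]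
        refine mul_le_mul_of_nonneg_left (Real.exp_le_exp.mpr ?_) (by positivity)
        linarith
    _ = _ := by ring

/-- Integrating the pointwise bound exactly recombines the two half exponentials; the factor 2 comes
from dividing by α(y/2). -/
lemma tailMass_le_of_large {α y R : ℝ} (hα : 0 < α) (hy : 0 < y) (hR : 0 < R)
    (hyR : 4 / α ≤ y * R ^ α) :
    tailMass α y R ≤ 2 * (2 * Real.pi / (α * y ^ (2 / α)) *
      (R ^ (2 - α) * y ^ (2 / α - 1) * Real.exp (-y * R ^ α))) := by
  obtain ⟨hi, he⟩ := integral_Ioi_rpow_mul_exp hα (half_pos hy) hR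
  have hi' : IntegrableOn (fun r : ℝ => r * Real.exp (-y * r ^ α)) (Set.Ioi R) := by
    have := (integrableOn_rpow_mul_exp_neg_mul_rpow (s := 1) (by norm_num) hα hy).mono_set
      (Set.Ioi_subset_Ioi hR.le)
    simpa using this
  have h := setIntegral_mono_on hi' (hi.const_mul (R ^ (2 - α) * Real.exp (-(y / 2) * R ^ α)))
    measurableSet_Ioi fun r hr => rpow_mul_exp_le hα hy hR hyR (le_of_lt hr)
  rw [integral_const_mul, he] at h
  rw [tailMass_eq α y hR.le]
  calc _ ≤ 2 * Real.pi * (R ^ (2 - α) * Real.exp (-(y / 2) * R ^ α) *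
        (Real.exp (-(y / 2) * R ^ α) / (α * (y / 2)))) := by gcongr
    _ = _ := by
        have e1 : Real.exp (-y * R ^ α) =
            Real.exp (-(y / 2) * R ^ α) * Real.exp (-(y / 2) * R ^ α) := by
          rw [← Real.exp_add]; ring_nf
        have e2 : y ^ (2 / α - 1) = y ^ (2 / α) / y := by rw [Real.rpow_sub hy, Real.rpow_one]
        rw [e1, e2]
        have := (Real.rpow_pos_of_pos hy (2 / α)).ne'
        field_simp

/-! ### The distribution function of the eavesdropper SNR -/

/-- The void probability `exp (-ρ ∫_{‖x‖ ≤ R} e^{-y‖x‖^α} dx)`. -/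
def voidProb (α ρ R y : ℝ) : ℝ := Real.exp (-(ρ * diskMass α y R))

lemma limitCdfED_eq (α ρ y : ℝ) : limitCdfED α ρ y =
    Real.exp (-(ρ * (2 * Real.pi / (α * y ^ (2 / α)) * Real.Gamma (2 / α)))) := by
  rw [limitCdfED]
  congr 1
  ring

/-- The disk is the plane minus the tail, so R enters only through this multiplicative correction.
-/
lemma voidProb_eq_limitCdfED_mul {α y : ℝ} (hα : 0 < α) (hy : 0 < y) (ρ R : ℝ) :
    voidProb α ρ R y = limitCdfED α ρ y * Real.exp (ρ * tailMass α y R) := by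
  rw [voidProb, limitCdfED_eq, ← Real.exp_add, ← diskMass_add_tailMass hα hy R]
  congr 1
  ring

/-- The relative correction to the limiting distribution function. -/
theorem abs_voidProb_div_sub_one_le {α ρ : ℝ} (hα : 0 < α) (hρ : 0 < ρ) {y₀ : ℝ} (hy₀ : 0 < y₀) :
    ∃ C R₀ : ℝ, 0 < C ∧ 0 < R₀ ∧ ∀ R y : ℝ, R₀ ≤ R → y₀ ≤ y →
      |voidProb α ρ R y / limitCdfED α ρ y - 1| ≤
        C * (2 * Real.pi * ρ / (α * y ^ (2 / α)) *
          (R ^ (2 - α) * y ^ (2 / α - 1) * Real.exp (-y * R ^ α))) := by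
  -- B bounds ρ times the tail mass for all y ≥ y₀ and all R. The radius R₀ solves y₀ R₀^α = 4/α,
  -- the threshold of `tailMass_le_of_large`.
  set B := ρ * (2 * Real.pi / (α * y₀ ^ (2 / α)) * Real.Gamma (2 / α)) with hB
  refine ⟨2 * Real.exp B, (4 / (α * y₀)) ^ (1 / α), by positivity, by positivity,
    fun R y hR hy => ?_⟩
  have hy0 : 0 < y := hy₀.trans_le hy
  have hR0 : 0 < R := lt_of_lt_of_le (by positivity) hR
  have hyR : 4 / α ≤ y * R ^ α := by
    have h1 : 4 / (α * y₀) ≤ R ^ α := by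
      have := Real.rpow_le_rpow (by positivity) hR hα.le
      rwa [← Real.rpow_mul (by positivity), one_div_mul_cancel hα.ne', Real.rpow_one] at this
    calc 4 / α = y₀ * (4 / (α * y₀)) := by field_simp
      _ ≤ y * R ^ α := by gcongr
  have hl : 0 < limitCdfED α ρ y := Real.exp_pos _
  set t := ρ * tailMass α y R with ht
  have ht0 : 0 ≤ t := mul_nonneg hρ.le (tailMass_nonneg _ _ _)
  have htB : t ≤ B := mul_le_mul_of_nonneg_left
    ((tailMass_anti hα hy₀ hy R).trans (tailMass_le hα hy₀ R)) hρ.le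
  have h1 : Real.exp t - 1 ≤ t * Real.exp t := by
    have h2 := Real.add_one_le_exp (-t)
    have h3 : Real.exp (-t) * Real.exp t = 1 := by rw [← Real.exp_add]; simp
    nlinarith [Real.exp_pos t]
  rw [voidProb_eq_limitCdfED_mul hα hy0, mul_div_cancel_left₀ _ hl.ne',
    abs_of_nonneg (by linarith [Real.add_one_le_exp t])]
  calc Real.exp t - 1 ≤ t * Real.exp t := h1
    _ ≤ (ρ * (2 * (2 * Real.pi / (α * y ^ (2 / α)) *
      (R ^ (2 - α) * y ^ (2 / α - 1) * Real.exp (-y * R ^ α))))) * Real.exp B := by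
        gcongr
        exact mul_le_mul_of_nonneg_left (tailMass_le_of_large hα hy0 hR0 hyR) hρ.le
    _ = _ := by ring

/-- The uniform distance to the limiting distribution function. -/
theorem abs_voidProb_sub_limitCdfED_le {α ρ : ℝ} (hα : 0 < α) (hρ : 0 < ρ) :
    ∃ C c : ℝ, 0 < C ∧ 0 < c ∧ ∀ R y : ℝ, 1 ≤ R → 0 < y →
      |voidProb α ρ R y - limitCdfED α ρ y| ≤ C * Real.exp (-c * R ^ (2 * α / (α + 2))) := by
  have hG : 0 < Real.Gamma (2 / α) := Real.Gamma_pos_of_pos (by positivity)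
  set B := ρ * (2 * Real.pi / α * 2 ^ (2 / α) * Real.Gamma (2 / α)) with hB
  have hB0 : 0 < B := by positivity
  -- The rate is the worse of the two regimes: ρπ/e from small y, 1/4 from large y.
  refine ⟨1 + 4 * B, min (ρ * (Real.exp (-1) * Real.pi)) (1 / 4), by positivity,
    lt_min (by positivity) (by norm_num), fun R y hR hy => ?_⟩
  have hR0 : 0 < R := by linarith
  set u := R ^ (2 * α / (α + 2)) with hu
  have hu0 : 0 < u := by positivity
  -- Balances the regimes: Y R^α (tail decay) and Y^{-2/α} (size of the disk mass) both equal u.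
  set Y := R ^ (-(α ^ 2 / (α + 2))) with hY
  have hY0 : 0 < Y := by positivity
  have hYR : Y * R ^ α = u := by
    rw [hY, ← Real.rpow_add hR0]
    congr 1
    field_simp
    ring
  have hY2 : Y ^ (-(2 / α)) = u := by
    rw [hY, ← Real.rpow_mul hR0.le]
    congr 1
    field_simp
  have hY1 : Y ^ (-(1 / α)) ≤ R := by
    rw [hY, ← Real.rpow_mul hR0.le]
    refine (Real.rpow_le_rpow_of_exponent_le hR ?_).trans_eq (Real.rpow_one R)
    rw [neg_mul_neg, div_mul_div_comm, div_le_one (by positivity)]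
    nlinarith
  have ht0 : 0 ≤ ρ * tailMass α y R := mul_nonneg hρ.le (tailMass_nonneg _ _ _)
  have hl : 0 < limitCdfED α ρ y := Real.exp_pos _
  have hle : limitCdfED α ρ y ≤ voidProb α ρ R y := by
    rw [voidProb_eq_limitCdfED_mul hα hy]
    exact le_mul_of_one_le_right hl.le (Real.one_le_exp ht0)
  rw [abs_of_nonneg (by linarith)]
  set c := min (ρ * (Real.exp (-1) * Real.pi)) (1 / 4) with hc
  rcases le_total y Y with h | h
  -- Small y: the difference is at most the void probability, whose exponent is already of order u.
  · have h1 : ρ * (Real.exp (-1) * (Real.pi * u)) ≤ ρ * diskMass α y R := by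
      rw [← hY2]
      exact mul_le_mul_of_nonneg_left
        ((le_diskMass hα hY0 hY1).trans (diskMass_anti hα hy h R)) hρ.le
    have h2 : c * u ≤ ρ * (Real.exp (-1) * Real.pi) * u :=
      mul_le_mul_of_nonneg_right (min_le_left _ _) hu0.le
    calc voidProb α ρ R y - limitCdfED α ρ y ≤ voidProb α ρ R y := by linarith
      _ ≤ Real.exp (-c * u) := Real.exp_le_exp.mpr (by linarith)
      _ ≤ (1 + 4 * B) * Real.exp (-c * u) :=
        le_mul_of_one_le_left (by positivity) (by linarith)
  -- Large y: the difference is at most ρ times the tail mass, which decreases in y and is therefore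
  -- estimated at Y.
  · have h1 : limitCdfED α ρ y = voidProb α ρ R y * Real.exp (-(ρ * tailMass α y R)) := by
      rw [voidProb_eq_limitCdfED_mul hα hy, mul_assoc, ← Real.exp_add]
      simp
    have hv0 : 0 ≤ voidProb α ρ R y := (Real.exp_pos _).le
    have hv1 : voidProb α ρ R y ≤ 1 := Real.exp_le_one_iff.mpr
      (neg_nonpos.mpr (mul_nonneg hρ.le (diskMass_nonneg _ _ _)))
    have h2 : voidProb α ρ R y - limitCdfED α ρ y ≤ ρ * tailMass α y R := by
      rw [h1]
      nlinarith [Real.add_one_le_exp (-(ρ * tailMass α y R))]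
    have h3 : tailMass α y R ≤ _ := (tailMass_anti hα hY0 h R).trans (tailMass_le_exp hα hY0 hR0.le)
    have h4 : Real.exp (-(Y / 2) * R ^ α) *
        (2 * Real.pi / (α * (Y / 2) ^ (2 / α)) * Real.Gamma (2 / α)) =
        Real.exp (-(u / 2)) * (2 * Real.pi / α * 2 ^ (2 / α) * Real.Gamma (2 / α)) * u := by
      rw [← hY2, Real.div_rpow hY0.le (by norm_num), Real.rpow_neg hY0.le]
      have : -(Y / 2) * R ^ α = -(Y ^ (-(2 / α)) / 2) := by rw [hY2, ← hYR]; ring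
      rw [this, Real.rpow_neg hY0.le]
      have := (Real.rpow_pos_of_pos hY0 (2 / α)).ne'
      field_simp
    -- The linear factor u costs half of the decay rate, through u/4 + 1 ≤ e^{u/4}.
    have h5 : u * Real.exp (-(u / 2)) ≤ 4 * Real.exp (-(1 / 4) * u) := by
      have h6 := Real.add_one_le_exp (u / 4)
      have h7 : Real.exp (-(1 / 4) * u) = Real.exp (u / 4) * Real.exp (-(u / 2)) := by
        rw [← Real.exp_add]; ring_nf
      rw [h7]
      nlinarith [Real.exp_pos (-(u / 2))]
    have h8 : Real.exp (-(1 / 4) * u) ≤ Real.exp (-c * u) := by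
      have : c * u ≤ 1 / 4 * u := mul_le_mul_of_nonneg_right (min_le_right _ _) hu0.le
      exact Real.exp_le_exp.mpr (by linarith)
    calc voidProb α ρ R y - limitCdfED α ρ y ≤ ρ * tailMass α y R := h2
      _ ≤ ρ * (Real.exp (-(u / 2)) *
          (2 * Real.pi / α * 2 ^ (2 / α) * Real.Gamma (2 / α)) * u) := by
        rw [← h4]
        exact mul_le_mul_of_nonneg_left h3 hρ.le
      _ = B * (u * Real.exp (-(u / 2))) := by rw [hB]; ring
      _ ≤ B * (4 * Real.exp (-c * u)) := by
        exact mul_le_mul_of_nonneg_left (h5.trans (by linarith)) hB0.le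
      _ ≤ (1 + 4 * B) * Real.exp (-c * u) := by nlinarith [Real.exp_pos (-c * u)]

/-! ### Rayleigh fading -/

lemma gaussianPDF_half_mul (x y : ℝ) :
    gaussianPDF 0 (1 / 2) x * gaussianPDF 0 (1 / 2) y =
      ENNReal.ofReal (Real.pi⁻¹ * Real.exp (-(x ^ 2 + y ^ 2))) := by
  rw [gaussianPDF, gaussianPDF, ← ENNReal.ofReal_mul (gaussianPDFReal_nonneg _ _ _)]
  congr 1
  have h1 : (2 : ℝ) * Real.pi * ((1 / 2 : NNReal) : ℝ) = Real.pi := by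
    push_cast; ring
  have h2 : (2 : ℝ) * ((1 / 2 : NNReal) : ℝ) = 1 := by push_cast; norm_num
  rw [gaussianPDFReal, gaussianPDFReal, h1, h2]
  have h3 : (√Real.pi)⁻¹ * (√Real.pi)⁻¹ = Real.pi⁻¹ := by
    rw [← mul_inv, Real.mul_self_sqrt Real.pi_pos.le]
  rw [mul_mul_mul_comm, h3, ← Real.exp_add]
  congr 2
  ring

lemma complexGaussian_eq_withDensity :
    complexGaussian = (volume : Measure ℂ).withDensity
      fun z => ENNReal.ofReal (Real.pi⁻¹ * Real.exp (-‖z‖ ^ 2)) := by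
  have hm : Measurable fun z : ℂ => ENNReal.ofReal (Real.pi⁻¹ * Real.exp (-‖z‖ ^ 2)) := by fun_prop
  have hv : (1 / 2 : NNReal) ≠ 0 := by norm_num
  ext s hs
  have he := Complex.measurableEquivRealProd.symm.measurable
  have hvp := Complex.volume_preserving_equiv_real_prod.symm Complex.measurableEquivRealProd
  rw [complexGaussian, Measure.map_apply he hs, gaussianReal_of_var_ne_zero 0 hv,
    prod_withDensity (measurable_gaussianPDF _ _) (measurable_gaussianPDF _ _),
    withDensity_apply _ (he hs), withDensity_apply _ hs, ← hvp.setLIntegral_comp_preimage hs hm]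
  refine lintegral_congr fun z => ?_
  rw [gaussianPDF_half_mul]
  congr 3
  rw [← Complex.normSq_eq_norm_sq, Complex.normSq_apply]
  simp [Complex.measurableEquivRealProd, pow_two]

instance : IsProbabilityMeasure complexGaussian := by
  unfold complexGaussian
  exact Measure.isProbabilityMeasure_map
    Complex.measurableEquivRealProd.symm.measurable.aemeasurable

/-- Circles are null sets, so strict and weak SNR inequalities can be interchanged. -/
lemma complexGaussian_norm_sq_eq (t : ℝ) : complexGaussian {z | ‖z‖ ^ 2 = t} = 0 := by
  rw [complexGaussian_eq_withDensity]
  refine withDensity_absolutelyContinuous _ _ (measure_mono_null ?_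
    (Measure.addHaar_sphere volume (0 : ℂ) √t))
  intro z hz
  simp only [Set.mem_ofPred_eq] at hz
  simp [← hz]

lemma integral_fun_norm_complex (f : ℝ → ℝ) :
    ∫ z : ℂ, f ‖z‖ = 2 * Real.pi * ∫ r in Set.Ioi (0 : ℝ), r * f r := by
  have h : volume.real (Metric.ball (0 : ℂ) 1) = Real.pi := by
    simp [measureReal_def, Complex.volume_ball]
  rw [integral_fun_norm_addHaar, h]
  simp [mul_assoc]

/-- Rayleigh fading: |h|² is Exp(1). In polar coordinates this is the elementary tail integral with
exponent 2. -/
lemma complexGaussian_lt_norm_sq {t : ℝ} (ht : 0 < t) :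
    complexGaussian {z | t < ‖z‖ ^ 2} = ENNReal.ofReal (Real.exp (-t)) := by
  have hs : MeasurableSet {z : ℂ | t < ‖z‖ ^ 2} := measurableSet_lt (by fun_prop) (by fun_prop)
  have hst : 0 < √t := Real.sqrt_pos.mpr ht
  have hi : Integrable fun z : ℂ => Real.pi⁻¹ * Real.exp (-‖z‖ ^ 2) := by
    refine Integrable.const_mul ?_ _
    refine (integrable_fun_norm_addHaar (volume : Measure ℂ)
      (f := fun r => Real.exp (-r ^ 2))).mpr ?_
    have := integrableOn_rpow_mul_exp_neg_mul_rpow (s := 1) (p := 2) (b := 1) (by norm_num)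
      (by norm_num) one_pos
    simpa using this
  rw [complexGaussian_eq_withDensity, withDensity_apply _ hs,
    ← ofReal_integral_eq_lintegral_ofReal hi.integrableOn
      (Eventually.of_forall fun z => by positivity)]
  congr 1
  have h := integral_fun_norm_complex
    ((Set.Ioi √t).indicator fun r => Real.pi⁻¹ * Real.exp (-r ^ 2))
  have h2 : ∫ r in Set.Ioi (0 : ℝ), r *
      (Set.Ioi √t).indicator (fun r => Real.pi⁻¹ * Real.exp (-r ^ 2)) r =
      ∫ r in Set.Ioi √t, Real.pi⁻¹ * (r ^ ((2 : ℝ) - 1) * Real.exp (-1 * r ^ (2 : ℝ))) := by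
    rw [← Set.inter_eq_self_of_subset_right (Set.Ioi_subset_Ioi hst.le),
      ← setIntegral_indicator measurableSet_Ioi, Set.inter_eq_self_of_subset_right
        (Set.Ioi_subset_Ioi hst.le)]
    congr 1 with r
    simp only [Set.indicator, Set.mem_Ioi]
    split_ifs
    · norm_num
      ring
    · simp
  rw [h2, integral_const_mul, (integral_Ioi_rpow_mul_exp two_pos one_pos hst).2] at h
  rw [← integral_indicator hs]
  have h3 : (fun z : ℂ => {z : ℂ | t < ‖z‖ ^ 2}.indicator
      (fun z => Real.pi⁻¹ * Real.exp (-‖z‖ ^ 2)) z) = fun z : ℂ =>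
      (Set.Ioi √t).indicator (fun r => Real.pi⁻¹ * Real.exp (-r ^ 2)) ‖z‖ := by
    ext z
    have hz : t < ‖z‖ ^ 2 ↔ √t < ‖z‖ := by
      rw [← sq_lt_sq₀ (Real.sqrt_nonneg t) (norm_nonneg z), Real.sq_sqrt ht.le]
    simp only [Set.indicator, Set.mem_ofPred_eq, Set.mem_Ioi, hz]
  rw [h3, h]
  have h4 : √t ^ (2 : ℝ) = t := by
    rw [Real.rpow_two, Real.sq_sqrt ht.le]
  rw [h4]
  have := Real.pi_pos.ne'
  field_simp

lemma complexGaussian_norm_sq_le {t : ℝ} (ht : 0 ≤ t) :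
    complexGaussian {z | ‖z‖ ^ 2 ≤ t} = ENNReal.ofReal (1 - Real.exp (-t)) := by
  rcases ht.eq_or_lt with rfl | ht
  · simpa using complexGaussian_norm_sq_eq 0
  · have hs : MeasurableSet {z : ℂ | t < ‖z‖ ^ 2} := measurableSet_lt (by fun_prop) (by fun_prop)
    have h : {z : ℂ | ‖z‖ ^ 2 ≤ t} = {z : ℂ | t < ‖z‖ ^ 2}ᶜ := by ext z; simp
    rw [h, prob_compl_eq_one_sub hs, complexGaussian_lt_norm_sq ht,
      ENNReal.ofReal_sub _ (Real.exp_pos _).le, ENNReal.ofReal_one]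

lemma complexGaussian_norm_sq_lt {t : ℝ} (ht : 0 ≤ t) :
    complexGaussian {z | ‖z‖ ^ 2 < t} = ENNReal.ofReal (1 - Real.exp (-t)) := by
  rw [← complexGaussian_norm_sq_le ht]
  refine le_antisymm (measure_mono fun z hz => by
    simp only [Set.mem_ofPred_eq] at hz ⊢; exact hz.le) ?_
  have : {z : ℂ | ‖z‖ ^ 2 ≤ t} ⊆ {z | ‖z‖ ^ 2 < t} ∪ {z | ‖z‖ ^ 2 = t} :=
    fun z hz => by simpa [le_iff_lt_or_eq] using hz
  refine (measure_mono this).trans ((measure_union_le _ _).trans ?_)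
  rw [complexGaussian_norm_sq_eq t, add_zero]

/-! ### The density of the user SNR -/

/-- Binomial theorem with the k = 0 term split off; the left side is the distribution function of
the maximum of K exponentials. -/
lemma one_sub_exp_pow_eq (K : ℕ) (α d x : ℝ) :
    (1 - Real.exp (-d ^ α * x)) ^ K = 1 - ∑ k ∈ Finset.Icc 1 K,
      (-1) ^ (k + 1) * (K.choose k : ℝ) * Real.exp (-aCoeff α d k * x) := by
  have h := add_pow (-Real.exp (-d ^ α * x)) 1 K
  have hset : Finset.range (K + 1) = insert 0 (Finset.Icc 1 K) := by
    ext k; simp; omega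
  rw [hset, Finset.sum_insert (by simp)] at h
  rw [sub_eq_neg_add, h]
  simp only [pow_zero, one_pow, mul_one, Nat.choose_zero_right, Nat.cast_one]
  rw [sub_eq_add_neg, ← Finset.sum_neg_distrib]
  congr 1
  refine Finset.sum_congr rfl fun k _ => ?_
  have : Real.exp (-aCoeff α d k * x) = Real.exp (-d ^ α * x) ^ k := by
    rw [← Real.exp_nat_mul, aCoeff]
    congr 1
    ring
  rw [this, neg_pow, pow_succ]
  ring

lemma hasDerivAt_one_sub_exp_pow (K : ℕ) (α d x : ℝ) :
    HasDerivAt (fun x => (1 - Real.exp (-d ^ α * x)) ^ K) (densityUE K α d x) x := by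
  have h1 : (fun x => (1 - Real.exp (-d ^ α * x)) ^ K) = fun x => 1 - ∑ k ∈ Finset.Icc 1 K,
      (-1) ^ (k + 1) * (K.choose k : ℝ) * Real.exp (-aCoeff α d k * x) :=
    funext fun x => one_sub_exp_pow_eq K α d x
  rw [h1]
  have h2 := (HasDerivAt.fun_sum (u := Finset.Icc 1 K) (x := x) fun k _ =>
    (((hasDerivAt_id x).const_mul (-aCoeff α d k)).exp.const_mul
      ((-1 : ℝ) ^ (k + 1) * (K.choose k : ℝ)))).const_sub 1
  refine h2.congr_deriv ?_
  rw [densityUE, ← Finset.sum_neg_distrib]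
  refine Finset.sum_congr rfl fun k _ => ?_
  simp only [id]
  ring

/-- The alternating sum hides the sign. By uniqueness of derivatives it equals the chain-rule
derivative of the K-th power, visibly nonnegative. -/
lemma densityUE_nonneg (K : ℕ) (α : ℝ) {d x : ℝ} (hd : 0 < d) (hx : 0 ≤ x) :
    0 ≤ densityUE K α d x := by
  have h := ((((hasDerivAt_id x).const_mul (-d ^ α)).exp.const_sub 1).pow K)
  have hD : 0 < d ^ α := Real.rpow_pos_of_pos hd _
  have he : Real.exp (-d ^ α * x) ≤ 1 := Real.exp_le_one_iff.mpr (by nlinarith)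
  rw [(hasDerivAt_one_sub_exp_pow K α d x).unique h]
  simp only [id, mul_one]
  have h1 : 0 ≤ 1 - Real.exp (-d ^ α * x) := by linarith
  have h2 : 0 ≤ -(Real.exp (-d ^ α * x) * -d ^ α) := by
    have : 0 ≤ Real.exp (-d ^ α * x) * d ^ α := by positivity
    linarith
  positivity

lemma continuous_densityUE (K : ℕ) (α d : ℝ) : Continuous (densityUE K α d) := by
  unfold densityUE
  fun_prop

lemma lintegral_Iic_densityUE (K : ℕ) [NeZero K] (α : ℝ) {d : ℝ} (hd : 0 < d) (x : ℝ) :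
    ((volume.restrict (Set.Ioi 0)).withDensity fun x => ENNReal.ofReal (densityUE K α d x))
      (Set.Iic x) = ENNReal.ofReal ((1 - Real.exp (-d ^ α * max x 0)) ^ K) := by
  rw [withDensity_apply _ measurableSet_Iic, Measure.restrict_restrict measurableSet_Iic,
    Set.Iic_inter_Ioi]
  have hset : Set.Ioc 0 x = Set.Ioc 0 (max x 0) := by
    ext t
    simp only [Set.mem_Ioc, le_max_iff]
    constructor
    · rintro ⟨h1, h2⟩; exact ⟨h1, Or.inl h2⟩
    · rintro ⟨h1, h2 | h2⟩
      · exact ⟨h1, h2⟩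
      · linarith
  rw [hset]
  have hi : IntervalIntegrable (densityUE K α d) volume 0 (max x 0) :=
    (continuous_densityUE K α d).intervalIntegrable _ _
  have hi' : IntegrableOn (densityUE K α d) (Set.Ioc 0 (max x 0)) :=
    (intervalIntegrable_iff_integrableOn_Ioc_of_le (le_max_right _ _)).mp hi
  rw [← ofReal_integral_eq_lintegral_ofReal hi'
    ((ae_restrict_mem measurableSet_Ioc).mono fun t ht => densityUE_nonneg K α hd ht.1.le),
    ← intervalIntegral.integral_of_le (le_max_right _ _),
    intervalIntegral.integral_eq_sub_of_hasDerivAt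
      (fun t _ => hasDerivAt_one_sub_exp_pow K α d t) hi]
  -- The value at the lower endpoint is 0^K, which vanishes because K ≠ 0.
  simp [NeZero.ne K]

/-! ### The probability generating functional of a Poisson point process -/

lemma integral_pow_poissonMeasure (r : NNReal) (c : ℝ) :
    ∫ n : ℕ, c ^ n ∂(poissonMeasure r) = Real.exp (-((1 - c) * r)) := by
  rw [integral_poissonMeasure]
  have h : ∀ n : ℕ, (Real.exp (-r) * (r : ℝ) ^ n / n.factorial) • c ^ n =
      Real.exp (-r) * ((r * c) ^ n / n.factorial) := by
    intro n
    rw [smul_eq_mul, mul_pow]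
    ring
  simp only [h]
  rw [tsum_mul_left, (NormedSpace.expSeries_div_hasSum_exp (r * c : ℝ)).tsum_eq,
    ← Real.exp_eq_exp_ℝ, ← Real.exp_add]
  congr 1
  ring

section

variable {Ω : Type*} [MeasurableSpace Ω] {μ : Measure Ω}
  {N : Ω → ℕ} {X : ℕ → Ω → Plane} {Λ : Measure Plane} [IsFiniteMeasure Λ]

lemma measurable_prod_range {g : Plane → ℝ} (hN : Measurable N) (hX : ∀ e, Measurable (X e))
    (hg : Measurable g) : Measurable fun ω => ∏ e ∈ Finset.range (N ω), g (X e ω) := by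
  have h : Measurable fun a : ℕ × Ω => ∏ e ∈ Finset.range a.1, g (X e a.2) :=
    measurable_from_prod_countable_right fun n => by
      exact Finset.measurable_fun_prod (Finset.range n) fun e _ => hg.comp (hX e)
  exact h.comp (hN.prodMk measurable_id)

/-- Grouping the points by cell gives a product of c_i to the cell counts. These are independent
Poisson variables, so their generating functions multiply. -/
lemma integral_prod_step (h : IsPoissonPointProcess N X Λ μ) {n : ℕ} {ι : Plane → Fin n}
    (hι : Measurable ι) (c : Fin n → ℝ) :
    ∫ ω, ∏ e ∈ Finset.range (N ω), c (ι (X e ω)) ∂μ =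
      Real.exp (-∫ x, (1 - c (ι x)) ∂Λ) := by
  classical
  have hA : ∀ i, MeasurableSet (ι ⁻¹' {i}) := fun i => hι (measurableSet_singleton i)
  have hprod : ∀ ω, ∏ e ∈ Finset.range (N ω), c (ι (X e ω)) =
      ∏ i, c i ^ pointCount N X (ι ⁻¹' {i}) ω := by
    intro ω
    rw [← Finset.prod_fiberwise (Finset.range (N ω)) (fun e => ι (X e ω))]
    refine Finset.prod_congr rfl fun i _ => ?_
    rw [pointCount, ← Finset.prod_const]
    refine Finset.prod_congr ?_ ?_
    · ext e; simp
    · intro e he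
      simp only [Finset.mem_filter, Set.mem_preimage, Set.mem_singleton_iff] at he
      rw [he.2]
  have hind := (h.indep n (fun i => ι ⁻¹' {i}) hA fun i j hij =>
    Disjoint.preimage ι (Set.disjoint_singleton.mpr hij)).comp (fun i (m : ℕ) => c i ^ m)
    fun i => measurable_from_top
  have hlaw := fun i => h.law (ι ⁻¹' {i}) (hA i)
  simp only [hprod]
  have hm : ∀ i, AEStronglyMeasurable
      ((fun m : ℕ => c i ^ m) ∘ pointCount N X (ι ⁻¹' {i})) μ := fun i =>
    ((measurable_from_top (f := fun m : ℕ => c i ^ m)).comp_aemeasurable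
      (hlaw i).aemeasurable).aestronglyMeasurable
  have h1 := hind.integral_fun_prod_eq_prod_integral hm
  simp only [Function.comp] at h1
  rw [h1]
  have h2 : ∀ i, ∫ ω, c i ^ pointCount N X (ι ⁻¹' {i}) ω ∂μ =
      Real.exp (-((1 - c i) * Λ.real (ι ⁻¹' {i}))) := by
    intro i
    have := (hlaw i).integral_comp (f := fun m : ℕ => c i ^ m)
      measurable_from_top.aestronglyMeasurable
    simp only [Function.comp] at this
    rw [this, integral_pow_poissonMeasure]
    rfl
  simp only [h2]
  rw [← Real.exp_sum, Finset.sum_neg_distrib]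
  congr 2
  have h3 : ∫ x, (1 - c (ι x)) ∂Λ = ∫ i, (1 - c i) ∂(Λ.map ι) :=
    (integral_map hι.aemeasurable
      (measurable_from_top (f := fun i => 1 - c i)).aestronglyMeasurable).symm
  rw [h3, integral_fintype .of_finite]
  refine Finset.sum_congr rfl fun i _ => ?_
  rw [map_measureReal_apply hι (measurableSet_singleton i), smul_eq_mul, mul_comm]

/-- The **probability generating functional** of a Poisson point process. -/
theorem integral_prod_eq_exp [IsProbabilityMeasure μ] (h : IsPoissonPointProcess N X Λ μ) {g : Plane → ℝ}
    (hg : Measurable g) (hg0 : ∀ x, 0 ≤ g x) (hg1 : ∀ x, g x ≤ 1) :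
    ∫ ω, ∏ e ∈ Finset.range (N ω), g (X e ω) ∂μ = Real.exp (-∫ x, (1 - g x) ∂Λ) := by
  -- Step functions with values i/m, i ≤ m, converging to g. Both sides pass to the limit by
  -- domination by 1, Λ being finite.
  set gm : ℕ → Plane → ℝ := fun m x => (⌊g x * m⌋₊ : ℝ) / m with hgm
  have hgm0 : ∀ m x, 0 ≤ gm m x := fun m x => by positivity
  have hgm1 : ∀ m x, gm m x ≤ 1 := fun m x => by
    refine div_le_one_of_le₀ ((Nat.floor_le (by have := hg0 x; positivity)).trans ?_) (by positivity)
    exact mul_le_of_le_one_left (by positivity) (hg1 x)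
  have hgmm : ∀ m, Measurable (gm m) := fun m =>
    (measurable_from_top.comp (Nat.measurable_floor.comp (hg.mul_const _))).div_const _
  have hlim : ∀ x, Tendsto (fun m => gm m x) atTop (𝓝 (g x)) := fun x =>
    (tendsto_nat_floor_mul_div_atTop (hg0 x)).comp tendsto_natCast_atTop_atTop
  have hstep : ∀ m, ∫ ω, ∏ e ∈ Finset.range (N ω), gm m (X e ω) ∂μ =
      Real.exp (-∫ x, (1 - gm m x) ∂Λ) := by
    intro m
    have hlt : ∀ x, ⌊g x * m⌋₊ < m + 1 := fun x =>
      Nat.lt_succ_of_le (Nat.floor_le_of_le (mul_le_of_le_one_left (by positivity) (hg1 x)))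
    have hι : Measurable fun x => (⟨⌊g x * m⌋₊, hlt x⟩ : Fin (m + 1)) := by
      refine measurable_to_countable' fun i => ?_
      have : (fun x => (⟨⌊g x * m⌋₊, hlt x⟩ : Fin (m + 1))) ⁻¹' {i} =
          (fun x => ⌊g x * m⌋₊) ⁻¹' {(i : ℕ)} := by
        ext x; simp [Fin.ext_iff]
      rw [this]
      exact (Nat.measurable_floor.comp (hg.mul_const _)) (measurableSet_singleton _)
    exact integral_prod_step h hι fun i => ((i : ℕ) : ℝ) / m
  refine tendsto_nhds_unique (f := fun m => ∫ ω, ∏ e ∈ Finset.range (N ω), gm m (X e ω) ∂μ)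
    (l := atTop) ?_ ?_
  · refine tendsto_integral_of_dominated_convergence (fun _ => 1)
      (fun m => (measurable_prod_range h.measurable_number h.measurable_point
        (hgmm m)).aestronglyMeasurable) (integrable_const _) ?_ ?_
    · refine fun m => Eventually.of_forall fun ω => ?_
      rw [Real.norm_of_nonneg (Finset.prod_nonneg fun e _ => hgm0 _ _)]
      exact Finset.prod_le_one (fun e _ => hgm0 _ _) fun e _ => hgm1 _ _
    · exact Eventually.of_forall fun ω => tendsto_finsetProd _ fun e _ => hlim _
  · simp only [hstep]
    refine (Real.continuous_exp.tendsto _).comp (Tendsto.neg ?_)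
    refine tendsto_integral_of_dominated_convergence (fun _ => 1)
      (fun m => (measurable_const.sub (hgmm m)).aestronglyMeasurable) (integrable_const _) ?_ ?_
    · refine fun m => Eventually.of_forall fun x => ?_
      rw [Real.norm_of_nonneg (by linarith [hgm1 m x])]
      linarith [hgm0 m x]
    · exact Eventually.of_forall fun x => (hlim x).const_sub 1

end

/-! ### The downlink -/

/-- The index of a best antenna as a function of the fading coefficients to the user. -/
def bestAntenna {K : ℕ} [NeZero K] (α d : ℝ) (u : Fin K → ℂ) : Fin K :=
  Classical.epsilon fun k => ∀ j, ‖u j‖ ^ 2 / d ^ α ≤ ‖u k‖ ^ 2 / d ^ α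

/-- The gain of the best antenna. -/
def bestGain {K : ℕ} (α d : ℝ) (u : Fin K → ℂ) : ℝ := ⨆ k, ‖u k‖ ^ 2 / d ^ α

/-- The SNR at an eavesdropper at `x` for the fading coefficient `h`. -/
def pointSNR (α PB σ2 : ℝ) (x : Plane) (h : ℂ) : ENNReal :=
  ENNReal.ofReal (PB * ‖h‖ ^ 2) / ENNReal.ofReal (‖x‖ ^ α) / ENNReal.ofReal σ2

section

variable {K : ℕ}

lemma measurable_bestGain (α d : ℝ) : Measurable (bestGain α d : (Fin K → ℂ) → ℝ) :=
  Measurable.iSup fun k => by fun_prop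

variable [NeZero K]

/-- The choice operator factors through the finite type of predicates on `Fin K`, where every map is
measurable; no tie-breaking rule is needed. -/
lemma measurable_bestAntenna (α d : ℝ) : Measurable (bestAntenna α d : (Fin K → ℂ) → Fin K) := by
  have h1 : Measurable fun u : Fin K → ℂ => fun k : Fin K =>
      ∀ j, ‖u j‖ ^ 2 / d ^ α ≤ ‖u k‖ ^ 2 / d ^ α := by
    refine measurable_pi_lambda _ fun k => ?_
    refine measurableSet_setOfPred.mp (MeasurableSet.congr (s := ⋂ j, {u : Fin K → ℂ |
      ‖u j‖ ^ 2 / d ^ α ≤ ‖u k‖ ^ 2 / d ^ α}) (MeasurableSet.iInter fun j =>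
        measurableSet_le (by fun_prop) (by fun_prop)) ?_)
    ext u
    simp
  exact (measurable_of_finite (Classical.epsilon : (Fin K → Prop) → Fin K)).comp h1

lemma bestGain_le_iff {α d x : ℝ} {u : Fin K → ℂ} :
    bestGain α d u ≤ x ↔ ∀ k, ‖u k‖ ^ 2 / d ^ α ≤ x :=
  ciSup_le_iff (Set.finite_range _).bddAbove

lemma bestGain_nonneg {d : ℝ} (hd : 0 < d) (α : ℝ) (u : Fin K → ℂ) : 0 ≤ bestGain α d u :=
  (by positivity : 0 ≤ ‖u 0‖ ^ 2 / d ^ α).trans (bestGain_le_iff.mp le_rfl 0)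

end

lemma measurable_pointSNR (α PB σ2 : ℝ) :
    Measurable fun a : Plane × ℂ => pointSNR α PB σ2 a.1 a.2 := by
  unfold pointSNR
  fun_prop

lemma pointSNR_eq_ofReal {α PB σ2 : ℝ} (hσ : 0 < σ2) {x : Plane} (hx : x ≠ 0) (h : ℂ) :
    pointSNR α PB σ2 x h = ENNReal.ofReal (PB * ‖h‖ ^ 2 / ‖x‖ ^ α / σ2) := by
  have : 0 < ‖x‖ ^ α := Real.rpow_pos_of_pos (norm_pos_iff.mpr hx) _
  rw [pointSNR, ENNReal.ofReal_div_of_pos hσ, ENNReal.ofReal_div_of_pos this]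

lemma pointSNR_zero {α PB σ2 : ℝ} (hα : 0 < α) (hPB : 0 < PB) {h : ℂ} (hh : h ≠ 0) :
    pointSNR α PB σ2 0 h = ⊤ := by
  have : 0 < PB * ‖h‖ ^ 2 := by positivity
  rw [pointSNR, norm_zero, Real.zero_rpow hα.ne', ENNReal.ofReal_zero,
    ENNReal.div_zero (ENNReal.ofReal_pos.mpr this).ne', ENNReal.top_div_of_ne_top (by simp)]

/-- Also valid at the origin, where the SNR is infinite unless h = 0 and the right side reads |h|² ≤
0. -/
lemma pointSNR_le_iff {α PB σ2 y : ℝ} (hα : 0 < α) (hPB : 0 < PB) (hσ : 0 < σ2) (hy : 0 ≤ y)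
    (x : Plane) (h : ℂ) :
    pointSNR α PB σ2 x h ≤ ENNReal.ofReal (PB / σ2 * y) ↔ ‖h‖ ^ 2 ≤ y * ‖x‖ ^ α := by
  rcases eq_or_ne x 0 with rfl | hx
  · rcases eq_or_ne h 0 with rfl | hh
    · simp [pointSNR, Real.zero_rpow hα.ne']
    · rw [pointSNR_zero hα hPB hh]
      simp [Real.zero_rpow hα.ne', hh]
  · have hx' : 0 < ‖x‖ ^ α := Real.rpow_pos_of_pos (norm_pos_iff.mpr hx) _
    rw [pointSNR_eq_ofReal hσ hx, ENNReal.ofReal_le_ofReal_iff (by positivity), div_div,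
      div_le_iff₀ (by positivity)]
    have : PB / σ2 * y * (‖x‖ ^ α * σ2) = PB * (y * ‖x‖ ^ α) := by field_simp
    rw [this, mul_le_mul_iff_right₀ hPB]

lemma complexGaussian_pointSNR_le {α PB σ2 y : ℝ} (hα : 0 < α) (hPB : 0 < PB) (hσ : 0 < σ2)
    (hy : 0 ≤ y) (x : Plane) :
    complexGaussian {h | pointSNR α PB σ2 x h ≤ ENNReal.ofReal (PB / σ2 * y)} =
      ENNReal.ofReal (1 - Real.exp (-y * ‖x‖ ^ α)) := by
  simp only [pointSNR_le_iff hα hPB hσ hy]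
  rw [complexGaussian_norm_sq_le (by positivity), neg_mul]

lemma complexGaussian_pointSNR_lt {α PB σ2 y : ℝ} (hα : 0 < α) (hPB : 0 < PB) (hσ : 0 < σ2)
    (hy : 0 < y) (x : Plane) :
    complexGaussian {h | pointSNR α PB σ2 x h < ENNReal.ofReal (PB / σ2 * y)} =
      ENNReal.ofReal (1 - Real.exp (-y * ‖x‖ ^ α)) := by
  rw [← complexGaussian_pointSNR_le hα hPB hσ hy.le]
  refine le_antisymm (measure_mono fun z hz => by
    simp only [Set.mem_ofPred_eq] at hz ⊢; exact hz.le) ?_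
  rw [complexGaussian_pointSNR_le hα hPB hσ hy.le, neg_mul,
    ← complexGaussian_norm_sq_lt (by positivity)]
  refine measure_mono fun h hh => ?_
  simp only [Set.mem_ofPred_eq] at hh ⊢
  rcases eq_or_ne x 0 with rfl | hx
  · simp only [norm_zero, Real.zero_rpow hα.ne', mul_zero] at hh
    exact absurd hh (not_lt.mpr (by positivity))
  · have hx' : 0 < ‖x‖ ^ α := Real.rpow_pos_of_pos (norm_pos_iff.mpr hx) _
    rw [pointSNR_eq_ofReal hσ hx, ENNReal.ofReal_lt_ofReal_iff (by positivity), div_div,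
      div_lt_iff₀ (by positivity)]
    have : PB / σ2 * y * (‖x‖ ^ α * σ2) = PB * (y * ‖x‖ ^ α) := by field_simp
    rw [this]
    exact mul_lt_mul_of_pos_left hh hPB

namespace Downlink

variable {K : ℕ} {ρ R : ℝ} (M : Downlink K ρ R)

/-- The two families use disjoint index blocks of one mutually independent family, so the σ-algebras
they generate are independent. -/
lemma indepFun_fading : IndepFun (fun ω k => M.hBU k ω) (fun ω k e => M.hBE k e ω) M.μ := by
  have hm : ∀ i, Measurable ((Sum.elim M.hBU (fun i : Fin K × ℕ => M.hBE i.1 i.2) :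
      Fin K ⊕ (Fin K × ℕ) → M.Ω → ℂ) i) := by
    rintro (k | ⟨k, e⟩)
    · exact M.measurable_hBU k
    · exact M.measurable_hBE k e
  have h := indep_iSup_of_disjoint (fun i => (hm i).comap_le) M.indep_fading.iIndep
    (S := Set.range Sum.inl) (T := Set.range Sum.inr) (by
      rw [Set.disjoint_left]
      rintro _ ⟨a, rfl⟩ ⟨b, hb⟩
      exact absurd hb (by simp))
  rw [IndepFun_iff_Indep]
  refine indep_of_indep_of_le_left (indep_of_indep_of_le_right h ?_) ?_
  · rw [← measurable_iff_comap_le]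
    refine @measurable_pi_lambda _ _ _ (_) _ _ fun k => @measurable_pi_lambda _ _ _ (_) _ _ fun e => ?_
    rw [measurable_iff_comap_le]
    exact le_iSup₂_of_le (Sum.inr (k, e)) ⟨_, rfl⟩ le_rfl
  · rw [← measurable_iff_comap_le]
    refine @measurable_pi_lambda _ _ _ (_) _ _ fun k => ?_
    rw [measurable_iff_comap_le]
    exact le_iSup₂_of_le (Sum.inl k) ⟨_, rfl⟩ le_rfl

lemma measure_forall_lt_hBE_mem (k : Fin K) (n : ℕ) (B : ℕ → Set ℂ)
    (hB : ∀ e, MeasurableSet (B e)) :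
    M.μ {ω | ∀ e < n, M.hBE k e ω ∈ B e} = ∏ e ∈ Finset.range n, complexGaussian (B e) := by
  have hind : iIndepFun (fun e => M.hBE k e) M.μ :=
    M.indep_fading.precomp (g := fun e : ℕ => (Sum.inr (k, e) : Fin K ⊕ (Fin K × ℕ)))
      fun a b hab => by simpa using hab
  have h := hind.measure_inter_preimage_eq_mul (Finset.range n) (sets := B) fun e _ => hB e
  have hs : {ω | ∀ e < n, M.hBE k e ω ∈ B e} = ⋂ e ∈ Finset.range n, M.hBE k e ⁻¹' B e := by
    ext ω; simp
  rw [hs, h]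
  refine Finset.prod_congr rfl fun e _ => ?_
  rw [← Measure.map_apply (M.measurable_hBE k e) (hB e), (M.law_hBE k e).map_eq]

variable [NeZero K]

/-- A maximum is at most x iff all its terms are, so independence gives the K-th power of an
exponential distribution function; the laws are compared on half-lines. -/
lemma map_bestGain {d : ℝ} (hd : 0 < d) (α : ℝ) :
    M.μ.map (fun ω => bestGain α d fun k => M.hBU k ω) =
      (volume.restrict (Set.Ioi 0)).withDensity fun x => ENNReal.ofReal (densityUE K α d x) := by
  have hm : Measurable fun ω => bestGain α d fun k => M.hBU k ω :=
    (measurable_bestGain α d).comp (measurable_pi_lambda _ M.measurable_hBU)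
  have hD : 0 < d ^ α := Real.rpow_pos_of_pos hd _
  have : IsProbabilityMeasure (M.μ.map fun ω => bestGain α d fun k => M.hBU k ω) :=
    Measure.isProbabilityMeasure_map hm.aemeasurable
  refine Measure.ext_of_Iic _ _ fun x => ?_
  rw [lintegral_Iic_densityUE K α hd, Measure.map_apply hm measurableSet_Iic]
  have hind : iIndepFun M.hBU M.μ :=
    M.indep_fading.precomp (g := fun k : Fin K => (Sum.inl k : Fin K ⊕ (Fin K × ℕ)))
      Sum.inl_injective
  have hs : (fun ω => bestGain α d fun k => M.hBU k ω) ⁻¹' Set.Iic x =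
      ⋂ k ∈ (Finset.univ : Finset (Fin K)), M.hBU k ⁻¹' {z | ‖z‖ ^ 2 ≤ x * d ^ α} := by
    ext ω
    simp [bestGain_le_iff, div_le_iff₀ hD]
  have hB : MeasurableSet {z : ℂ | ‖z‖ ^ 2 ≤ x * d ^ α} :=
    measurableSet_le (by fun_prop) (by fun_prop)
  rw [hs, hind.measure_inter_preimage_eq_mul Finset.univ fun _ _ => hB]
  have h1 : ∀ k, M.μ (M.hBU k ⁻¹' {z | ‖z‖ ^ 2 ≤ x * d ^ α}) =
      ENNReal.ofReal (1 - Real.exp (-d ^ α * max x 0)) := by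
    intro k
    rw [← Measure.map_apply (M.measurable_hBU k) hB, (M.law_hBU k).map_eq]
    rcases le_total 0 x with hx | hx
    · rw [complexGaussian_norm_sq_le (by positivity), max_eq_left hx]
      congr 3
      ring
    · rw [max_eq_right hx]
      simp only [mul_zero, Real.exp_zero, sub_self, ENNReal.ofReal_zero]
      refine measure_mono_null (fun z hz => ?_) (complexGaussian_norm_sq_eq 0)
      simp only [Set.mem_ofPred_eq] at hz ⊢
      have : x * d ^ α ≤ 0 := mul_nonpos_of_nonpos_of_nonneg hx hD.le
      exact le_antisymm (hz.trans this) (by positivity)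
  have h2 : 0 ≤ 1 - Real.exp (-d ^ α * max x 0) := by
    have : Real.exp (-d ^ α * max x 0) ≤ 1 :=
      Real.exp_le_one_iff.mpr (by nlinarith [le_max_right x 0])
    linarith
  simp only [h1, Finset.prod_const, Finset.card_univ, Fintype.card_fin, ENNReal.ofReal_pow h2]

/-- The probability that the fading coefficients from the best antenna to all eavesdroppers lie in
given sets. -/
theorem measure_forall_mem (α d : ℝ) {B : Set ((Fin K → ℂ) × Plane × ℂ)} (hB : MeasurableSet B)
    {g : (Fin K → ℂ) → Plane → ℝ} (hg : ∀ u, Measurable (g u)) (hg0 : ∀ u x, 0 ≤ g u x)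
    (hg1 : ∀ u x, g u x ≤ 1)
    (hBg : ∀ u x, complexGaussian {h | (u, x, h) ∈ B} = ENNReal.ofReal (g u x)) :
    M.μ {ω | ∀ e < M.N ω, (fun k => M.hBU k ω, M.X e ω, M.hBE (M.selected α d ω) e ω) ∈ B} =
      ∫⁻ ω, ENNReal.ofReal (Real.exp (-∫ x, (1 - g (fun k => M.hBU k ω) x)
        ∂(ENNReal.ofReal ρ • volume.restrict (Metric.closedBall (0 : Plane) R)))) ∂M.μ := by
  set U : M.Ω → Fin K → ℂ := fun ω k => M.hBU k ω with hU
  set V : M.Ω → Fin K → ℕ → ℂ := fun ω k e => M.hBE k e ω with hV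
  set W : M.Ω → ℕ × (ℕ → Plane) := fun ω => (M.N ω, fun e => M.X e ω) with hW
  have mU : Measurable U := measurable_pi_lambda _ M.measurable_hBU
  have mV : Measurable V :=
    measurable_pi_lambda _ fun k => measurable_pi_lambda _ fun e => M.measurable_hBE k e
  have mW : Measurable W :=
    M.poisson.measurable_number.prodMk (measurable_pi_lambda _ M.poisson.measurable_point)
  have := Measure.isProbabilityMeasure_map (μ := M.μ) mU.aemeasurable
  have := Measure.isProbabilityMeasure_map (μ := M.μ) mV.aemeasurable
  have := Measure.isProbabilityMeasure_map (μ := M.μ) mW.aemeasurable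
  -- User gains, eavesdropper gains and points are jointly independent, so the probability becomes
  -- an iterated integral.
  have hmap : M.μ.map (fun ω => ((U ω, V ω), W ω)) =
      ((M.μ.map U).prod (M.μ.map V)).prod (M.μ.map W) := by
    rw [← (indepFun_iff_map_prod_eq_prod_map_map mU.aemeasurable mV.aemeasurable).mp
      M.indepFun_fading]
    exact (indepFun_iff_map_prod_eq_prod_map_map (mU.prodMk mV).aemeasurable
      mW.aemeasurable).mp M.indep_points
  have hbase : MeasurableSet {a : (((ℕ × (ℕ → Plane)) × (Fin K → ℂ)) × (Fin K → ℕ → ℂ)) |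
      ∀ e < a.1.1.1, (a.1.2, a.1.1.2 e, a.2 (bestAntenna α d a.1.2) e) ∈ B} := by
    have : {a : (((ℕ × (ℕ → Plane)) × (Fin K → ℂ)) × (Fin K → ℕ → ℂ)) |
        ∀ e < a.1.1.1, (a.1.2, a.1.1.2 e, a.2 (bestAntenna α d a.1.2) e) ∈ B} =
        ⋂ e : ℕ, ({a | a.1.1.1 ≤ e} ∪
          {a | (a.1.2, a.1.1.2 e, a.2 (bestAntenna α d a.1.2) e) ∈ B}) := by
      ext a
      simp only [Set.mem_ofPred_eq, Set.mem_iInter, Set.mem_union]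
      refine forall_congr' fun e => ?_
      rw [← not_lt, imp_iff_not_or]
    rw [this]
    refine MeasurableSet.iInter fun e => MeasurableSet.union
      (measurableSet_le (by fun_prop) measurable_const) ?_
    -- The random antenna index takes finitely many values, so evaluating at it is measurable.
    have hsel : Measurable fun b : Fin K × (Fin K → ℕ → ℂ) => b.2 b.1 e :=
      measurable_from_prod_countable_right fun k => by fun_prop
    have h1 : Measurable fun a : (((ℕ × (ℕ → Plane)) × (Fin K → ℂ)) × (Fin K → ℕ → ℂ)) =>
        a.2 (bestAntenna α d a.1.2) e :=
      hsel.comp (((measurable_bestAntenna α d).comp (by fun_prop)).prodMk measurable_snd)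
    have h2 : Measurable fun a : (((ℕ × (ℕ → Plane)) × (Fin K → ℂ)) × (Fin K → ℕ → ℂ)) =>
        (a.1.2, a.1.1.2 e, a.2 (bestAntenna α d a.1.2) e) := by fun_prop
    exact h2 hB
  set E : Set (((Fin K → ℂ) × (Fin K → ℕ → ℂ)) × (ℕ × (ℕ → Plane))) :=
    {a | ∀ e < a.2.1, (a.1.1, a.2.2 e, a.1.2 (bestAntenna α d a.1.1) e) ∈ B} with hE
  have mE : MeasurableSet E := by
    have : Measurable fun a : ((Fin K → ℂ) × (Fin K → ℕ → ℂ)) × (ℕ × (ℕ → Plane)) =>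
        ((a.2, a.1.1), a.1.2) := by fun_prop
    exact this hbase
  have hev : {ω | ∀ e < M.N ω, (fun k => M.hBU k ω, M.X e ω, M.hBE (M.selected α d ω) e ω) ∈ B} =
      (fun ω => ((U ω, V ω), W ω)) ⁻¹' E := rfl
  have hmeas := measurable_measure_prodMk_left (ν := M.μ.map V) hbase
  rw [hev, ← Measure.map_apply ((mU.prodMk mV).prodMk mW) mE, hmap, Measure.prod_apply_symm mE]
  have h1 : ∀ w, ((M.μ.map U).prod (M.μ.map V)) ((fun a => (a, w)) ⁻¹' E) =
      ∫⁻ u, (M.μ.map V) {v | ∀ e < w.1, (u, w.2 e, v (bestAntenna α d u) e) ∈ B} ∂(M.μ.map U) :=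
    fun w => Measure.prod_apply (mE.preimage (by fun_prop))
  simp only [h1]
  -- The user gains go outermost: for fixed u the antenna is deterministic, the eavesdropper gains
  -- integrate to a product over the points, and the generating functional handles the points.
  rw [lintegral_lintegral_swap hmeas.aemeasurable]
  rw [lintegral_map ?_ mU]
  · refine lintegral_congr fun ω => ?_
    set u := U ω
    have hBm : ∀ x, MeasurableSet {h | (u, x, h) ∈ B} := fun x =>
      hB.preimage (by fun_prop)
    have h2 : ∀ w : ℕ × (ℕ → Plane),
        (M.μ.map V) {v | ∀ e < w.1, (u, w.2 e, v (bestAntenna α d u) e) ∈ B} =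
          ENNReal.ofReal (∏ e ∈ Finset.range w.1, g u (w.2 e)) := by
      intro w
      have hms : MeasurableSet {v : Fin K → ℕ → ℂ |
          ∀ e < w.1, (u, w.2 e, v (bestAntenna α d u) e) ∈ B} :=
        hbase.preimage (measurable_prodMk_left (x := (w, u)))
      rw [Measure.map_apply mV hms,
        ENNReal.ofReal_prod_of_nonneg fun e _ => hg0 _ _]
      simp only [← hBg]
      exact M.measure_forall_lt_hBE_mem (bestAntenna α d u) w.1
        (fun e => {h | (u, w.2 e, h) ∈ B}) fun e => hBm _
    simp only [h2]
    have hpm : Measurable fun w : ℕ × (ℕ → Plane) => ∏ e ∈ Finset.range w.1, g u (w.2 e) :=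
      measurable_prod_range (Ω := ℕ × (ℕ → Plane)) (N := Prod.fst) (X := fun e w => w.2 e)
        measurable_fst (fun e => by fun_prop) (hg u)
    have : IsFiniteMeasure (volume.restrict (Metric.closedBall (0 : Plane) R)) :=
      ⟨by rw [Measure.restrict_apply_univ]; exact measure_closedBall_lt_top⟩
    have := Measure.smul_finite (volume.restrict (Metric.closedBall (0 : Plane) R))
      (ENNReal.ofReal_ne_top (r := ρ))
    rw [lintegral_map hpm.ennreal_ofReal mW, ← integral_prod_eq_exp M.poisson (hg u) (hg0 u) (hg1 u)]
    refine (ofReal_integral_eq_lintegral_ofReal ?_ (Eventually.of_forall fun ω =>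
      Finset.prod_nonneg fun e _ => hg0 _ _)).symm
    refine Integrable.of_bound (hpm.comp mW).aestronglyMeasurable 1 (Eventually.of_forall fun ω => ?_)
    rw [Real.norm_of_nonneg (Finset.prod_nonneg fun e _ => hg0 _ _)]
    exact Finset.prod_le_one (fun e _ => hg0 _ _) fun e _ => hg1 _ _
  · exact (hmeas.lintegral_prod_left' (μ := M.μ.map W))

end Downlink

/-! ### Mixing the void probability over the user gain -/

lemma measurable_voidProb (α ρ R : ℝ) : Measurable (voidProb α ρ R) := by
  have h : Measurable fun y => diskMass α y R := by
    have hm : Measurable (Function.uncurry fun (y : ℝ) (x : Plane) =>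
        Real.exp (-y * ‖x‖ ^ α)) := by
      simp only [Function.uncurry_def]
      fun_prop
    exact hm.stronglyMeasurable.integral_prod_right.measurable
  unfold voidProb
  fun_prop

lemma integral_disk_eq {ρ : ℝ} (hρ : 0 < ρ) (α R y : ℝ) :
    ∫ x, (1 - (1 - Real.exp (-y * ‖x‖ ^ α)))
      ∂(ENNReal.ofReal ρ • volume.restrict (Metric.closedBall (0 : Plane) R)) =
      ρ * diskMass α y R := by
  simp only [sub_sub_cancel]
  rw [integral_smul_measure, ENNReal.toReal_ofReal hρ.le, smul_eq_mul, diskMass]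

lemma one_sub_exp_nonneg {y t : ℝ} (hy : 0 ≤ y) (ht : 0 ≤ t) : 0 ≤ 1 - Real.exp (-y * t) := by
  have : Real.exp (-y * t) ≤ 1 := Real.exp_le_one_iff.mpr (by nlinarith)
  linarith

namespace Downlink

variable {K : ℕ} [NeZero K] {ρ R : ℝ} (M : Downlink K ρ R)

lemma snrED_eq (α d PB σ2 : ℝ) (ω : M.Ω) :
    M.snrED α d PB σ2 ω = (Finset.range (M.N ω)).sup fun e =>
      pointSNR α PB σ2 (M.X e ω) (M.hBE (M.selected α d ω) e ω) := by
  rw [Finset.sup_eq_iSup]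
  rfl

lemma measurableSet_forall_mem (α d : ℝ) {B : Set ((Fin K → ℂ) × Plane × ℂ)}
    (hB : MeasurableSet B) : MeasurableSet
      {ω | ∀ e < M.N ω, (fun k => M.hBU k ω, M.X e ω, M.hBE (M.selected α d ω) e ω) ∈ B} := by
  have mU : Measurable fun ω k => M.hBU k ω := measurable_pi_lambda _ M.measurable_hBU
  have hs : {ω | ∀ e < M.N ω,
      (fun k => M.hBU k ω, M.X e ω, M.hBE (M.selected α d ω) e ω) ∈ B} =
      ⋂ e : ℕ, ({ω | M.N ω ≤ e} ∪
        {ω | (fun k => M.hBU k ω, M.X e ω, M.hBE (M.selected α d ω) e ω) ∈ B}) := by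
    ext ω
    simp only [Set.mem_ofPred_eq, Set.mem_iInter, Set.mem_union]
    refine forall_congr' fun e => ?_
    rw [← not_lt, imp_iff_not_or]
  rw [hs]
  refine MeasurableSet.iInter fun e => MeasurableSet.union
    (measurableSet_le M.poisson.measurable_number measurable_const) ?_
  have hsel : Measurable fun b : Fin K × M.Ω => M.hBE b.1 e b.2 :=
    measurable_from_prod_countable_right fun k => M.measurable_hBE k e
  have h1 : Measurable fun ω => M.hBE (M.selected α d ω) e ω :=
    hsel.comp (((measurable_bestAntenna α d).comp mU).prodMk measurable_id)
  exact (mU.prodMk ((M.poisson.measurable_point e).prodMk h1)) hB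

/-- The distribution function of the largest eavesdropper SNR. -/
theorem cdfED_eq {α PB σ2 y : ℝ} (hα : 0 < α) (hρ : 0 < ρ) (hPB : 0 < PB) (hσ : 0 < σ2)
    (hy : 0 < y) (d : ℝ) : M.cdfED α d PB σ2 y = voidProb α ρ R y := by
  have hset : {ω | M.snrED α d PB σ2 ω < ENNReal.ofReal (PB / σ2 * y)} =
      {ω | ∀ e < M.N ω, (fun k => M.hBU k ω, M.X e ω, M.hBE (M.selected α d ω) e ω) ∈
        {a : (Fin K → ℂ) × Plane × ℂ |
          pointSNR α PB σ2 a.2.1 a.2.2 < ENNReal.ofReal (PB / σ2 * y)}} := by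
    ext ω
    -- With no eavesdroppers the supremum is ⊥ = 0, so the strict inequality requires a positive
    -- threshold.
    have h0 : (⊥ : ENNReal) < ENNReal.ofReal (PB / σ2 * y) :=
      ENNReal.ofReal_pos.mpr (by positivity)
    simp only [Set.mem_ofPred_eq, snrED_eq, Finset.sup_lt_iff h0, Finset.mem_range]
  have h := M.measure_forall_mem α d
    (B := {a : (Fin K → ℂ) × Plane × ℂ |
      pointSNR α PB σ2 a.2.1 a.2.2 < ENNReal.ofReal (PB / σ2 * y)})
    (measurableSet_lt ((measurable_pointSNR α PB σ2).comp measurable_snd) measurable_const)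
    (g := fun _ x => 1 - Real.exp (-y * ‖x‖ ^ α)) (fun _ => by fun_prop)
    (fun _ x => one_sub_exp_nonneg hy.le (by positivity))
    (fun _ x => by linarith [Real.exp_pos (-y * ‖x‖ ^ α)])
    (fun _ x => complexGaussian_pointSNR_lt hα hPB hσ hy x)
  rw [cdfED, measureReal_def, hset, h, integral_disk_eq hρ, lintegral_const, measure_univ, mul_one,
    ENNReal.toReal_ofReal (Real.exp_pos _).le]
  rfl

lemma ae_bestGain_pos {d : ℝ} (hd : 0 < d) (α : ℝ) :
    ∀ᵐ ω ∂M.μ, 0 < bestGain α d fun k => M.hBU k ω := by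
  have hm : Measurable fun ω => bestGain α d fun k => M.hBU k ω :=
    (measurable_bestGain α d).comp (measurable_pi_lambda _ M.measurable_hBU)
  refine ae_of_ae_map (p := fun x => 0 < x) hm.aemeasurable ?_
  rw [M.map_bestGain hd α]
  exact (withDensity_absolutelyContinuous _ _).ae_le (ae_restrict_mem measurableSet_Ioi)

lemma integral_bestGain {d : ℝ} (hd : 0 < d) (α : ℝ) {φ : ℝ → ℝ} (hφ : Measurable φ) :
    ∫ ω, φ (bestGain α d fun k => M.hBU k ω) ∂M.μ =
      ∫ x in Set.Ioi (0 : ℝ), densityUE K α d x * φ x := by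
  have hm : Measurable fun ω => bestGain α d fun k => M.hBU k ω :=
    (measurable_bestGain α d).comp (measurable_pi_lambda _ M.measurable_hBU)
  rw [← integral_map (φ := fun ω => bestGain α d fun k => M.hBU k ω) hm.aemeasurable
    hφ.aestronglyMeasurable, M.map_bestGain hd α, integral_withDensity_eq_integral_toReal_smul
    (continuous_densityUE K α d).measurable.ennreal_ofReal (by simp)]
  refine setIntegral_congr_fun measurableSet_Ioi fun x hx => ?_
  simp only [smul_eq_mul]
  rw [ENNReal.toReal_ofReal (densityUE_nonneg K α hd (le_of_lt hx))]

/-- The outage probability as a mixture of void probabilities. -/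
theorem outageProb_eq {α d PB σ2 : ℝ} (hα : 0 < α) (hd : 0 < d) (hρ : 0 < ρ) (hPB : 0 < PB)
    (hσ : 0 < σ2) (ε : ℝ) :
    M.outageProb α d PB σ2 ε =
      1 - ∫ x in Set.Ioi (0 : ℝ), densityUE K α d x * voidProb α ρ R (x / 2 ^ ε) := by
  have hβ : (0 : ℝ) < 2 ^ ε := by positivity
  set B : Set ((Fin K → ℂ) × Plane × ℂ) := {a |
    pointSNR α PB σ2 a.2.1 a.2.2 ≤ ENNReal.ofReal (PB / σ2 * (bestGain α d a.1 / 2 ^ ε))} with hB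
  have mB : MeasurableSet B :=
    measurableSet_le ((measurable_pointSNR α PB σ2).comp measurable_snd)
      (((((measurable_bestGain α d).comp measurable_fst).div_const _).const_mul _).ennreal_ofReal)
  set E := {ω | ∀ e < M.N ω, (fun k => M.hBU k ω, M.X e ω, M.hBE (M.selected α d ω) e ω) ∈ B}
    with hE
  have hy : ∀ u : Fin K → ℂ, 0 ≤ bestGain α d u / 2 ^ ε := fun u =>
    div_nonneg (bestGain_nonneg hd α u) hβ.le
  have h := M.measure_forall_mem α d mB
    (g := fun u x => 1 - Real.exp (-(bestGain α d u / 2 ^ ε) * ‖x‖ ^ α)) (fun _ => by fun_prop)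
    (fun u x => one_sub_exp_nonneg (hy u) (by positivity))
    (fun u x => by linarith [Real.exp_pos (-(bestGain α d u / 2 ^ ε) * ‖x‖ ^ α)])
    (fun u x => complexGaussian_pointSNR_le hα hPB hσ (hy u) x)
  -- Only almost everywhere: if both SNRs vanish, 0/0 = 0 counts as an outage although E holds. A
  -- positive user gain excludes this.
  have hae : ({ω | M.snrUE α d PB σ2 ω / M.snrED α d PB σ2 ω < ENNReal.ofReal (2 ^ ε)}ᶜ : Set M.Ω)
      =ᵐ[M.μ] E := by
    rw [Filter.eventuallyEq_set]
    filter_upwards [M.ae_bestGain_pos hd α] with ω hω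
    have hUE : M.snrUE α d PB σ2 ω =
        ENNReal.ofReal (PB * (bestGain α d fun k => M.hBU k ω) / σ2) := rfl
    have hpos : M.snrUE α d PB σ2 ω ≠ 0 := by
      rw [hUE]; exact (ENNReal.ofReal_pos.mpr (by positivity)).ne'
    have hfin : M.snrUE α d PB σ2 ω ≠ ⊤ := by rw [hUE]; exact ENNReal.ofReal_ne_top
    have hdiv : M.snrUE α d PB σ2 ω / ENNReal.ofReal (2 ^ ε) =
        ENNReal.ofReal (PB / σ2 * ((bestGain α d fun k => M.hBU k ω) / 2 ^ ε)) := by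
      rw [hUE, ← ENNReal.ofReal_div_of_pos hβ]
      congr 1
      field_simp
    simp only [Set.mem_compl_iff, Set.mem_ofPred_eq, not_lt, hE, hB]
    rw [ENNReal.le_div_iff_mul_le (Or.inr hpos) (Or.inr hfin), mul_comm,
      ← ENNReal.le_div_iff_mul_le (Or.inl (ENNReal.ofReal_pos.mpr hβ).ne')
        (Or.inl ENNReal.ofReal_ne_top), hdiv, snrED_eq, Finset.sup_le_iff]
    simp only [Finset.mem_range]
  have mE : MeasurableSet E := M.measurableSet_forall_mem α d mB
  have hae' : ({ω | M.snrUE α d PB σ2 ω / M.snrED α d PB σ2 ω < ENNReal.ofReal (2 ^ ε)} : Set M.Ω)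
      =ᵐ[M.μ] (Eᶜ : Set M.Ω) := by
    simpa using hae.compl
  have hreal : M.μ.real E =
      ∫ ω, voidProb α ρ R ((bestGain α d fun k => M.hBU k ω) / 2 ^ ε) ∂M.μ := by
    rw [measureReal_def, hE, h, integral_eq_lintegral_of_nonneg_ae]
    · simp only [integral_disk_eq hρ]
      rfl
    · exact Eventually.of_forall fun ω => (Real.exp_pos _).le
    · exact (((measurable_voidProb α ρ R).comp (measurable_id.div_const _)).comp
        ((measurable_bestGain α d).comp
          (measurable_pi_lambda _ M.measurable_hBU))).aestronglyMeasurable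
  rw [outageProb, measureReal_congr hae', probReal_compl_eq_one_sub mE, hreal,
    M.integral_bestGain hd α (φ := fun z => voidProb α ρ R (z / 2 ^ ε))
      ((measurable_voidProb α ρ R).comp (measurable_id.div_const _))]

end Downlink

/-! ### The limit and the error bounds -/

lemma integrableOn_exp_neg_mul {a : ℝ} (ha : 0 < a) :
    IntegrableOn (fun x => Real.exp (-a * x)) (Set.Ioi 0) := by
  simpa using integrableOn_rpow_mul_exp_neg_mul_rpow (s := 0) (p := 1) (by norm_num) one_pos ha

lemma aCoeff_pos (α : ℝ) {d : ℝ} (hd : 0 < d) {k : ℕ} (hk : 0 < k) : 0 < aCoeff α d k := by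
  unfold aCoeff
  positivity

lemma integrableOn_densityUE (K : ℕ) (α : ℝ) {d : ℝ} (hd : 0 < d) :
    IntegrableOn (densityUE K α d) (Set.Ioi 0) := by
  unfold densityUE
  exact integrable_finsetSum _ fun k hk =>
    (integrableOn_exp_neg_mul (aCoeff_pos α hd (Finset.mem_Icc.mp hk).1)).const_mul _

/-- The recursion Γ(1 + 2/α) = (2/α) Γ(2/α) absorbs the factor 2/α, which explains the form of b. -/
lemma limitCdfED_div {α : ℝ} (hα : 0 < α) (ρ ε : ℝ) {x : ℝ} (hx : 0 < x) :
    limitCdfED α ρ (x / 2 ^ ε) = Real.exp (-(bCoeff α ρ ε * x ^ (-(2 / α)))) := by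
  have hβ : (0 : ℝ) < 2 ^ ε := by positivity
  rw [limitCdfED, bCoeff, add_comm 1 (2 / α), Real.Gamma_add_one (by positivity),
    Real.div_rpow hx.le hβ.le, Real.rpow_neg hx.le]
  congr 1
  have := (Real.rpow_pos_of_pos hx (2 / α)).ne'
  have := (Real.rpow_pos_of_pos hβ (2 / α)).ne'
  field_simp

lemma bCoeff_pos {α ρ : ℝ} (hα : 0 < α) (hρ : 0 < ρ) (ε : ℝ) : 0 < bCoeff α ρ ε := by
  have := Real.Gamma_pos_of_pos (s := 1 + 2 / α) (by positivity)
  unfold bCoeff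
  positivity

lemma integral_densityUE_mul_limitCdfED (K : ℕ) {α d ρ : ℝ} (hα : 0 < α) (hd : 0 < d) (hρ : 0 < ρ)
    (ε : ℝ) :
    IntegrableOn (fun x => densityUE K α d x * limitCdfED α ρ (x / 2 ^ ε)) (Set.Ioi 0) ∧
    ∫ x in Set.Ioi (0 : ℝ), densityUE K α d x * limitCdfED α ρ (x / 2 ^ ε) =
      ∑ k ∈ Finset.Icc 1 K, (-1) ^ (k + 1) * (K.choose k : ℝ) *
        stretchedIntegral (2 / α) (aCoeff α d k ^ (2 / α) * bCoeff α ρ ε) := by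
  have hb := bCoeff_pos hα hρ ε
  have hfun : Set.EqOn (fun x => densityUE K α d x * limitCdfED α ρ (x / 2 ^ ε))
      (fun x => ∑ k ∈ Finset.Icc 1 K, (-1) ^ (k + 1) * (K.choose k : ℝ) *
        (aCoeff α d k * Real.exp (-aCoeff α d k * x) *
          Real.exp (-(bCoeff α ρ ε * x ^ (-(2 / α)))))) (Set.Ioi 0) := by
    intro x hx
    simp only
    rw [limitCdfED_div hα ρ ε hx, densityUE, Finset.sum_mul]
    exact Finset.sum_congr rfl fun k _ => by ring
  have hi : ∀ k ∈ Finset.Icc 1 K, Integrable (fun x => (-1) ^ (k + 1) * (K.choose k : ℝ) *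
        (aCoeff α d k * Real.exp (-aCoeff α d k * x) *
          Real.exp (-(bCoeff α ρ ε * x ^ (-(2 / α)))))) (volume.restrict (Set.Ioi 0)) := by
    intro k hk
    have ha := aCoeff_pos α hd (Finset.mem_Icc.mp hk).1
    refine Integrable.const_mul ?_ _
    refine ((integrableOn_exp_neg_mul ha).const_mul (aCoeff α d k)).mono'
      (by fun_prop : Measurable _).aestronglyMeasurable ?_
    filter_upwards [ae_restrict_mem measurableSet_Ioi] with x hx
    have : 0 ≤ bCoeff α ρ ε * x ^ (-(2 / α)) := mul_nonneg hb.le (Real.rpow_nonneg (le_of_lt hx) _)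
    rw [Real.norm_of_nonneg (by positivity)]
    exact mul_le_of_le_one_right (by positivity) (Real.exp_le_one_iff.mpr (by linarith))
  constructor
  · exact IntegrableOn.congr_fun (integrable_finsetSum _ hi) hfun.symm measurableSet_Ioi
  · rw [setIntegral_congr_fun measurableSet_Ioi hfun, integral_finsetSum _ hi]
    refine Finset.sum_congr rfl fun k hk => ?_
    rw [integral_const_mul, integral_exp_mul_exp_rpow _ _ (aCoeff_pos α hd (Finset.mem_Icc.mp hk).1)]

lemma voidProb_nonneg (α ρ R y : ℝ) : 0 ≤ voidProb α ρ R y := (Real.exp_pos _).le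

lemma voidProb_le_one {ρ : ℝ} (hρ : 0 < ρ) (α R y : ℝ) : voidProb α ρ R y ≤ 1 :=
  Real.exp_le_one_iff.mpr (neg_nonpos.mpr (mul_nonneg hρ.le (diskMass_nonneg _ _ _)))

/-- The mixing weight is nonnegative and integrable, so a uniform bound on the distribution
functions passes to the mixtures. -/
lemma abs_integral_densityUE_sub_le (K : ℕ) {α d ρ : ℝ} (hα : 0 < α) (hd : 0 < d)
    (hρ : 0 < ρ) (R ε : ℝ) {δ : ℝ}
    (h : ∀ y, 0 < y → |voidProb α ρ R y - limitCdfED α ρ y| ≤ δ) :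
    |(∫ x in Set.Ioi (0 : ℝ), densityUE K α d x * voidProb α ρ R (x / 2 ^ ε)) -
      ∫ x in Set.Ioi (0 : ℝ), densityUE K α d x * limitCdfED α ρ (x / 2 ^ ε)| ≤
      (∫ x in Set.Ioi (0 : ℝ), densityUE K α d x) * δ := by
  have hf := integrableOn_densityUE K α hd
  have hi1 : IntegrableOn (fun x => densityUE K α d x * voidProb α ρ R (x / 2 ^ ε)) (Set.Ioi 0) := by
    refine Integrable.mono hf ((continuous_densityUE K α d).measurable.mul
      ((measurable_voidProb α ρ R).comp (measurable_id.div_const _))).aestronglyMeasurable ?_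
    refine Eventually.of_forall fun x => ?_
    rw [norm_mul, Real.norm_of_nonneg (voidProb_nonneg _ _ _ _)]
    exact mul_le_of_le_one_right (norm_nonneg _) (voidProb_le_one hρ _ _ _)
  rw [← integral_sub hi1 (integral_densityUE_mul_limitCdfED K hα hd hρ ε).1, ← integral_mul_const,
    ← Real.norm_eq_abs]
  refine norm_integral_le_of_norm_le (hf.mul_const δ) ?_
  filter_upwards [ae_restrict_mem measurableSet_Ioi] with x hx
  have hx0 : 0 < x := hx
  have hfx := densityUE_nonneg K α hd hx0.le
  rw [← mul_sub, norm_mul, Real.norm_of_nonneg hfx]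
  exact mul_le_mul_of_nonneg_left (h _ (by positivity)) hfx

lemma outageProb_error_bound {K p q : ℕ} [NeZero K] (hp : 0 < p) (hq : 0 < q) {α d ρ PB σ2 : ℝ}
    (hα : α = (p : ℝ) / (q : ℝ)) (hd : 0 < d) (hρ : 0 < ρ) (hPB : 0 < PB) (hσ : 0 < σ2) (ε : ℝ) :
    ∃ C c : ℝ, 0 < C ∧ 0 < c ∧ ∀ (R : ℝ) (M : Downlink K ρ R), 1 ≤ R →
      ‖((M.outageProb α d PB σ2 ε : ℝ) : ℂ) - outageClosedForm K p q d ρ ε‖ ≤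
        C * Real.exp (-c * R ^ (2 * α / (α + 2))) := by
  have hα0 : 0 < α := by rw [hα]; positivity
  obtain ⟨C, c, hC, hc, h⟩ := abs_voidProb_sub_limitCdfED_le hα0 hρ
  have hI : 0 ≤ ∫ x in Set.Ioi (0 : ℝ), densityUE K α d x :=
    setIntegral_nonneg measurableSet_Ioi fun x hx => densityUE_nonneg K α hd (le_of_lt hx)
  -- The extra C makes the constant positive knowing only that the mass of the density is
  -- nonnegative.
  refine ⟨(∫ x in Set.Ioi (0 : ℝ), densityUE K α d x) * C + C, c, by positivity, hc,
    fun R M hR => ?_⟩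
  have h1 := abs_integral_densityUE_sub_le K hα0 hd hρ R ε fun y hy => h R y hR hy
  rw [outageClosedForm_eq hp hq hd hρ, ← hα, ← Complex.ofReal_sub, Complex.norm_real,
    M.outageProb_eq hα0 hd hρ hPB hσ, ← (integral_densityUE_mul_limitCdfED K hα0 hd hρ ε).2,
    sub_sub_sub_cancel_left, norm_sub_rev, Real.norm_eq_abs]
  refine h1.trans ?_
  rw [add_mul, mul_assoc]
  exact le_add_of_nonneg_right (by positivity)

lemma tendsto_exp_neg_mul_rpow {c s : ℝ} (hc : 0 < c) (hs : 0 < s) :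
    Tendsto (fun R : ℝ => Real.exp (-c * R ^ s)) atTop (𝓝 0) :=
  Real.tendsto_exp_atBot.comp ((tendsto_rpow_atTop hs).const_mul_atTop_of_neg (by linarith))

end SecrecyOutage

end

theorem proposition1 (K : ℕ) [NeZero K] (p q : ℕ) (hp : 0 < p) (hq : 0 < q)
    (α : ℝ) (hα : α = (p : ℝ) / (q : ℝ)) (d ρ PB σ2 ε : ℝ)
    (hd : 0 < d) (hρ : 0 < ρ) (hPB : 0 < PB) (hσ : 0 < σ2) :
    -- the approximation for large `R`
    (∀ M : (R : ℝ) → SecrecyOutage.Downlink K ρ R,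
      Tendsto (fun R => (((M R).outageProb α d PB σ2 ε : ℝ) : ℂ)) atTop
        (𝓝 (SecrecyOutage.outageClosedForm K p q d ρ ε))) ∧
    -- where `R` enters: the exact outage probability depends on `R` only through the distribution
    -- function of the ED SNR ...
    (∀ (R : ℝ) (M : SecrecyOutage.Downlink K ρ R),
      M.outageProb α d PB σ2 ε =
        1 - ∫ x in Set.Ioi (0 : ℝ),
          SecrecyOutage.densityUE K α d x * M.cdfED α d PB σ2 (x / 2 ^ ε)) ∧
    -- ... whose `R`-dependent correction decays exponentially in `R ^ α`
    (∀ y₀ : ℝ, 0 < y₀ → ∃ C R₀ : ℝ, 0 < C ∧ 0 < R₀ ∧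
      ∀ (R : ℝ) (M : SecrecyOutage.Downlink K ρ R) (y : ℝ), R₀ ≤ R → y₀ ≤ y →
        |M.cdfED α d PB σ2 y / SecrecyOutage.limitCdfED α ρ y - 1| ≤
          C * (2 * Real.pi * ρ / (α * y ^ (2 / α)) *
            (R ^ (2 - α) * y ^ (2 / α - 1) * Real.exp (-y * R ^ α)))) ∧
    -- the resulting error bound for the outage probability itself
    (∃ C c : ℝ, 0 < C ∧ 0 < c ∧ ∀ (R : ℝ) (M : SecrecyOutage.Downlink K ρ R), 1 ≤ R →
      ‖((M.outageProb α d PB σ2 ε : ℝ) : ℂ) - SecrecyOutage.outageClosedForm K p q d ρ ε‖ ≤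
        C * Real.exp (-c * R ^ (2 * α / (α + 2)))) ∧
    -- the special case `α = 2`
    (α = 2 → SecrecyOutage.outageClosedForm K p q d ρ ε =
      ((1 - 2 * ∑ k ∈ Finset.Icc 1 K, (-1) ^ (k + 1) * (K.choose k : ℝ) *
        (Real.sqrt (SecrecyOutage.aCoeff α d k * SecrecyOutage.bCoeff α ρ ε) *
          SecrecyOutage.besselK 1
            (2 * Real.sqrt (SecrecyOutage.aCoeff α d k * SecrecyOutage.bCoeff α ρ ε))) : ℝ) : ℂ)) := by
  have hα0 : 0 < α := by rw [hα]; positivity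
  refine ⟨fun M => ?_, fun R M => ?_, fun y₀ hy₀ => ?_, ?_, fun hα2 => ?_⟩
  -- Convergence follows from the explicit rate, whose constants serve all models at once, so the
  -- spaces for different R need not be related.
  · obtain ⟨C, c, hC, hc, hbound⟩ :=
      SecrecyOutage.outageProb_error_bound (K := K) hp hq hα hd hρ hPB hσ ε
    rw [tendsto_iff_norm_sub_tendsto_zero]
    have h0 := (SecrecyOutage.tendsto_exp_neg_mul_rpow hc
      (show 0 < 2 * α / (α + 2) by positivity)).const_mul C
    rw [mul_zero] at h0
    refine squeeze_zero' (Eventually.of_forall fun R => norm_nonneg _) ?_ h0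
    filter_upwards [eventually_ge_atTop 1] with R hR
    exact hbound R (M R) hR
  · rw [M.outageProb_eq hα0 hd hρ hPB hσ]
    congr 1
    refine setIntegral_congr_fun measurableSet_Ioi fun x hx => ?_
    have hx0 : 0 < x := hx
    rw [M.cdfED_eq hα0 hρ hPB hσ (by positivity)]
  · obtain ⟨C, R₀, hC, hR₀, h⟩ := SecrecyOutage.abs_voidProb_div_sub_one_le hα0 hρ hy₀
    refine ⟨C, R₀, hC, hR₀, fun R M y hR hy => ?_⟩
    rw [M.cdfED_eq hα0 hρ hPB hσ (hy₀.trans_le hy)]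
    exact h R y hR hy
  · exact SecrecyOutage.outageProb_error_bound hp hq hα hd hρ hPB hσ ε
  · rw [SecrecyOutage.outageClosedForm_eq hp hq hd hρ, ← hα, Finset.mul_sum]
    congr 2
    refine Finset.sum_congr rfl fun k hk => ?_
    have ha := SecrecyOutage.aCoeff_pos α hd (Finset.mem_Icc.mp hk).1
    have hb := SecrecyOutage.bCoeff_pos hα0 hρ ε
    have h1 : 2 / α = 1 := by rw [hα2]; norm_num
    rw [h1, Real.rpow_one, SecrecyOutage.stretchedIntegral_one (mul_pos ha hb)]
    ring
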